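/- **Matrix product formula for the homogeneous two-species $U_q(A^{(1)}_2)$ zero range process.** Write $(z)_n=\prod_{j=1}^{n}(1-zq^{j-1})$, $\binom{n}{k}_q=\frac{(q)_n}{(q)_k(q)_{n-k}}$ (zero unless $0\le k\le n$), and $|\alpha|=\alpha_1+\alpha_2$ for $\alpha=(\alpha_1,\alpha_2)\in\mathbb Z_{\ge0}^2$. Let $L\ge1$, $0<q<1$, $0<\mu<1$, and let $m=(m_1,m_2)\in\mathbb Z_{\ge0}^2$ with $m_2\ge1$. Configurations are $\sigma=(\sigma_1,\dots,\sigma_L)$ with $\sigma_i=(\sigma_{i,1},\sigma_{i,2})\in\mathbb Z_{\ge0}^2$ and sites $i\in\mathbb Z_L$; the sector $S(m)$ is the finite set of those with $\sum_i\sigma_i=m$. *Discrete time process.* For $\mu<\lambda<1$ let $$\Phi(\gamma|\beta)=q^{(\beta_1-\gamma_1)\gamma_2}\Bigl(\frac{\mu}{\lambda}\Bigr)^{|\gamma|}\frac{(\lambda)_{|\gamma|}(\mu/\lambda)_{|\beta|-|\gamma|}}{(\mu)_{|\beta|}}\binom{\beta_1}{\gamma_1}_q\binom{\beta_2}{\gamma_2}_q,$$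 which is zero unless $\gamma\le\beta$ componentwise. The transfer matrix $T(\lambda|\mu)$ has the element from $\beta$ to $\alpha$ $$T_\beta^\alpha=\sum_{\gamma_1,\dots,\gamma_L\in\mathbb Z^2_{\ge0}}\ \prod_{i\in\mathbb Z_L}\theta(\gamma_i+\alpha_i=\gamma_{i-1}+\beta_i)\,\Phi(\gamma_i|\beta_i),$$ where $\theta(\cdot)$ is $1$ if the condition holds and $0$ otherwise. *Continuous time process.* Let $H=aH^{(1)}+bH^{(2)}$ with $a,b\ge0$. Here $H^{(1)}$ (respectively $H^{(2)}$) is the Markov matrix of the process in which, independently at each site $i$ in state $\alpha=\sigma_i$, each group $\gamma\le\alpha$ with $|\gamma|\ge1$ hops to site $i+1$ (respectively $i-1$) with rate $$\frac{q^{(\alpha_1-\gamma_1)\gamma_2}\mu^{|\gamma|-1}(q)_{|\gamma|-1}}{(\mu q^{|\alpha|-|\gamma|})_{|\gamma|}}\binom{\alpha_1}{\gamma_1}_q\binom{\alpha_2}{\gamma_2}_q,\qquad\text{respectively}\qquad \frac{q^{\gamma_1(\alpha_2-\gamma_2)}(q)_{|\gamma|-1}}{(\mu q^{|\alpha|-|\gamma|})_{|\gamma|}}\binom{\alpha_1}{\gamma_1}_q\binom{\alpha_2}{\gamma_2}_q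 ;$$ each site contributes to the diagonal $-\sum_{i=0}^{|\alpha|-1}\frac{q^i}{1-\mu q^i}$, respectively $-\sum_{i=0}^{|\alpha|-1}\frac{1}{1-\mu q^i}$. *$q$-bosons.* On the Fock space with basis $|n\rangle$, $n\ge0$ (completed to formal infinite sums), let $\mathbf b_+|n\rangle=|n+1\rangle$, $\mathbf b_-|n\rangle=(1-q^n)|n-1\rangle$, $\mathbf k|n\rangle=q^n|n\rangle$, where $|-1\rangle=0$. Put $\frac{(zw\mathbf b_+)_\infty}{(z\mathbf b_+)_\infty}=\sum_{j\ge0}\frac{(w)_j}{(q)_j}z^j\mathbf b_+^j$, and let $\mathrm{Tr}(X)$ be the sum over $n\ge0$ of the coefficients of $|n\rangle$ in $X|n\rangle$. For $\sigma\in S(m)$ define $$\mathbb P(\sigma)=\left(\prod_{i=1}^L\frac{(\mu)_{\sigma_{i,1}+\sigma_{i,2}}}{(q)_{\sigma_{i,1}}(q)_{\sigma_{i,2}}}\right)\mathrm{Tr}\left(\frac{(\mu\mathbf b_+)_\infty}{(\mathbf b_+)_\infty}\mathbf k^{\sigma_{1,2}}\mathbf b_-^{\sigma_{1,1}}\cdots\frac{(\mu\mathbf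 b_+)_\infty}{(\mathbf b_+)_\infty}\mathbf k^{\sigma_{L,2}}\mathbf b_-^{\sigma_{L,1}}\right).$$ Then the following hold. 1. For every $\sigma\in S(m)$ the trace converges absolutely and $\mathbb P(\sigma)>0$. 2. For every $\lambda$ with $\mu<\lambda<1$, $\mathbb P$ is a steady state of $T(\lambda|\mu)$ in the sector: $\sum_{\beta\in S(m)}T_\beta^\alpha\,\mathbb P(\beta)=\mathbb P(\alpha)$ for all $\alpha\in S(m)$. Every real steady state of $T(\lambda|\mu)$ in the sector is a scalar multiple of $\mathbb P$. 3. For all $a,b\ge0$, $\mathbb P$ is a steady state of $H=aH^{(1)}+bH^{(2)}$ in the sector, i.e. $H\mathbb P=0$. If $a+b>0$, every real steady state of $H$ in the sector is a scalar multiple of $\mathbb P$. So in 2 and 3 the steady-state probabilities are $\mathbb P(\sigma)/\sum_{\tau\in S(m)}\mathbb P(\tau)$. 4. The inhomogeneous formula, specialized to $\mu_1=\dots=\mu_L=\mu$, agrees with $\mathbb P$ up to a factor that is constant on the sector: for every $\sigma\in S(m)$ the trace below converges absolutely, and $$\left(\prod_{i=1}^L\frac{\mu^{-|\sigma_i|}(\mu)_{|\sigma_i|}}{(q)_{\sigma_{i,1}}(q)_{\sigma_{i,2}}}\right)\mathrm{Tr}\left(\frac{(\mathbf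 b_+)_\infty}{(\mu^{-1}\mathbf b_+)_\infty}\mathbf k^{\sigma_{1,2}}\mathbf b_-^{\sigma_{1,1}}\cdots\frac{(\mathbf b_+)_\infty}{(\mu^{-1}\mathbf b_+)_\infty}\mathbf k^{\sigma_{L,2}}\mathbf b_-^{\sigma_{L,1}}\right)=\mu^{-2m_1-m_2}\,\mathbb P(\sigma).$$ -/

import Mathlib

open scoped BigOperators

noncomputable section

namespace QZRP

/-! ## `q`-series notation -/

/-- The `q`-Pochhammer symbol `(z; q)_m = ∏_{j=1}^m (1 - z q^{j-1})`. -/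
def qPoch (q z : ℝ) (m : ℕ) : ℝ := ∏ j ∈ Finset.range m, (1 - z * q ^ j)

/-- The `q`-binomial coefficient, zero unless `k ≤ m`. -/
def qBinom (q : ℝ) (m k : ℕ) : ℝ :=
  if k ≤ m then qPoch q q m / (qPoch q q k * qPoch q q (m - k)) else 0

/-! ## Local states and configurations -/

/-- A local state `α = (α₁, α₂)`: `α₁` particles of species 1, `α₂` particles of species 2. -/
abbrev Site := ℕ × ℕ

/-- The total number of particles `|α| = α₁ + α₂`. -/
def size (α : Site) : ℕ := α.1 + α.2

/-- A configuration on the ring with `L` sites. The sites are `Fin L`, where addition of indices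
is modulo `L`. -/
abbrev Config (L : ℕ) := Fin L → Site

/-- The set `S(m)` of the configurations with `m₁` particles of species 1 and `m₂` particles of
species 2 in total (the box `σ_i ≤ m` is implied by the sum and makes the set a `Finset`). -/
def sector (L : ℕ) (m : Site) : Finset (Config L) :=
  {σ ∈ Fintype.piFinset (fun _ : Fin L => Finset.Iic m) | ∑ i, σ i = m}

/-! ## The stochastic `R` matrix and the discrete time process -/

/-- The function `Φ_q(γ | β; l, μ)` for two species (zero unless `γ ≤ β`). -/
def Phi (q l μ : ℝ) (γ β : Site) : ℝ :=
  if γ ≤ β then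
    q ^ ((β.1 - γ.1) * γ.2) * (μ / l) ^ size γ *
      (qPoch q l (size γ) * qPoch q (μ / l) (size β - size γ) / qPoch q μ (size β)) *
      (qBinom q β.1 γ.1 * qBinom q β.2 γ.2)
  else 0

/-- The element `𝒮(l, μ)_{α,β}^{γ,δ}` of the stochastic `R` matrix. -/
def stochR (q l μ : ℝ) (α β γ δ : Site) : ℝ :=
  if γ + δ = α + β then Phi q l μ γ β else 0

/-- The matrix element `T_β^α` (from `β` to `α`) of the Markov transfer matrix
`T(l | μ_1, …, μ_L)`, i.e. `∑_{γ_1,…,γ_L} ∏_i 𝒮(l, μ_i)_{γ_{i-1}, β_i}^{γ_i, α_i}` with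
`γ_0 = γ_L`. The summand vanishes unless `γ_i ≤ β_i` for all `i`, so the sum is written over
that range. -/
def transferElem {L : ℕ} [NeZero L] (q l : ℝ) (μ : Fin L → ℝ) (β α : Config L) : ℝ :=
  ∑ γ ∈ Fintype.piFinset (fun i => Finset.Iic (β i)),
    ∏ i, stochR q l (μ i) (γ (i - 1)) (β i) (γ i) (α i)

/-! ## The continuous time process -/

/-- The coefficient of `|α - γ, β + γ⟩` in `h^{(1)} |α, β⟩`: for `|γ| ≥ 1` the rate at which `γ`
leaves a site in state `α` to the right, and for `γ = 0` the diagonal coefficient. -/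
def rateRight (q μ : ℝ) (γ α : Site) : ℝ :=
  if γ = 0 then -∑ i ∈ Finset.range (size α), q ^ i / (1 - μ * q ^ i)
  else
    q ^ ((α.1 - γ.1) * γ.2) * μ ^ (size γ - 1) * qPoch q q (size γ - 1) /
      qPoch q (μ * q ^ (size α - size γ)) (size γ) *
      (qBinom q α.1 γ.1 * qBinom q α.2 γ.2)

/-- The coefficient of `|α + γ, β - γ⟩` in `h^{(2)} |α, β⟩`: for `|γ| ≥ 1` the rate at which `γ`
leaves a site in state `β` to the left, and for `γ = 0` the diagonal coefficient. -/
def rateLeft (q μ : ℝ) (γ β : Site) : ℝ :=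
  if γ = 0 then -∑ i ∈ Finset.range (size β), 1 / (1 - μ * q ^ i)
  else
    q ^ (γ.1 * (β.2 - γ.2)) * qPoch q q (size γ - 1) /
      qPoch q (μ * q ^ (size β - size γ)) (size γ) *
      (qBinom q β.1 γ.1 * qBinom q β.2 γ.2)

/-- The configuration obtained from `σ` by moving the particles `γ` from site `i` to site `j`
(first remove, then add). -/
def move {L : ℕ} (σ : Config L) (i j : Fin L) (γ : Site) : Config L :=
  let τ := Function.update σ i (σ i - γ)
  Function.update τ j (τ j + γ)

/-- The matrix element from `β` to `α` of `H^{(1)} = ∑_{i ∈ ℤ_L} h^{(1)}_{i,i+1}`. -/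
def H1Elem {L : ℕ} [NeZero L] (q μ : ℝ) (β α : Config L) : ℝ :=
  ∑ i, ∑ γ ∈ Finset.Iic (β i), if move β i (i + 1) γ = α then rateRight q μ γ (β i) else 0

/-- The matrix element from `β` to `α` of `H^{(2)} = ∑_{i ∈ ℤ_L} h^{(2)}_{i-1,i}`. -/
def H2Elem {L : ℕ} [NeZero L] (q μ : ℝ) (β α : Config L) : ℝ :=
  ∑ i, ∑ γ ∈ Finset.Iic (β i), if move β i (i - 1) γ = α then rateLeft q μ γ (β i) else 0

/-- The matrix element from `β` to `α` of `H = a H^{(1)} + b H^{(2)}`. -/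
def HElem {L : ℕ} [NeZero L] (q μ a b : ℝ) (β α : Config L) : ℝ :=
  a * H1Elem q μ β α + b * H2Elem q μ β α

/-! ## Steady states in a sector -/

/-- `|v⟩ = ∑_{σ ∈ S(m)} v(σ) |σ⟩` satisfies `|v⟩ = T(l | μ_1, …, μ_L) |v⟩`. -/
def IsDiscreteSteady {L : ℕ} [NeZero L] (q l : ℝ) (μ : Fin L → ℝ) (m : Site)
    (v : Config L → ℝ) : Prop :=
  ∀ α ∈ sector L m, ∑ β ∈ sector L m, transferElem q l μ β α * v β = v α

/-- `|v⟩ = ∑_{σ ∈ S(m)} v(σ) |σ⟩` satisfies `(a H^{(1)} + b H^{(2)}) |v⟩ = 0`. -/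
def IsContinuousSteady {L : ℕ} [NeZero L] (q μ a b : ℝ) (m : Site)
    (v : Config L → ℝ) : Prop :=
  ∀ α ∈ sector L m, ∑ β ∈ sector L m, HElem q μ a b β α * v β = 0

/-! ## `q`-bosons -/

/-- The completed Fock space `∏_{n ≥ 0} ℝ |n⟩`: the sequence `v` stands for the formal sum
`∑_n v n |n⟩`. The completion is needed since series in `b_+` do not preserve finite sums. -/
abbrev Fock := ℕ → ℝ

/-- `b_+ |n⟩ = |n + 1⟩`. -/
def bPlus : Module.End ℝ Fock where
  toFun v n := if n = 0 then 0 else v (n - 1)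
  map_add' u v := by
    funext n
    by_cases h : n = 0 <;> simp [h]
  map_smul' c v := by
    funext n
    by_cases h : n = 0 <;> simp [h]

/-- `b_- |n⟩ = (1 - q^n) |n - 1⟩`, with `|-1⟩ = 0`. -/
def bMinus (q : ℝ) : Module.End ℝ Fock where
  toFun v n := (1 - q ^ (n + 1)) * v (n + 1)
  map_add' u v := by
    funext n
    simp [mul_add]
  map_smul' c v := by
    funext n
    simp [mul_left_comm]

/-- `k |n⟩ = q^n |n⟩`. -/
def kOp (q : ℝ) : Module.End ℝ Fock where
  toFun v n := q ^ n * v n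
  map_add' u v := by
    funext n
    simp [mul_add]
  map_smul' c v := by
    funext n
    simp [mul_left_comm]

/-- The operator `(z w b_+)_∞ / (z b_+)_∞`, defined by the series
`∑_{j ≥ 0} (w)_j / (q)_j z^j b_+^j`. The coefficient of `|n⟩` in `b_+^j v` vanishes for `j > n`,
so that the series is a finite sum in every coefficient. -/
def dilog (q z w : ℝ) : Module.End ℝ Fock where
  toFun v n := ∑ j ∈ Finset.range (n + 1),
    qPoch q w j / qPoch q q j * z ^ j * ((bPlus ^ j) v) n
  map_add' u v := by
    funext n
    simp [mul_add, Finset.sum_add_distrib]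
  map_smul' c v := by
    funext n
    simp [mul_left_comm, Finset.mul_sum]

/-- The diagonal element `⟨n|X|n⟩ / (q)_n`, i.e. the coefficient of `|n⟩` in `X |n⟩`. -/
def diagElem (X : Module.End ℝ Fock) (n : ℕ) : ℝ := X (Pi.single n 1) n

/-- The trace of `X` is convergent. -/
def TraceConverges (X : Module.End ℝ Fock) : Prop := Summable (diagElem X)

/-- The trace `Tr(X) = ∑_{n ≥ 0} ⟨n|X|n⟩ / (q)_n`. -/
def trace (X : Module.End ℝ Fock) : ℝ := ∑' n, diagElem X n

/-! ## Matrix product formulas -/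

/-- `Z_{σ_1}(μ_1) ⋯ Z_{σ_L}(μ_L)` with
`Z_α(μ) = (b_+)_∞ / (μ⁻¹ b_+)_∞ k^{α₂} b_-^{α₁}`. -/
def inhomWord {L : ℕ} (q : ℝ) (μ : Fin L → ℝ) (σ : Config L) : Module.End ℝ Fock :=
  (List.ofFn fun i =>
    dilog q (μ i)⁻¹ (μ i) * kOp q ^ (σ i).2 * bMinus q ^ (σ i).1).prod

/-- The inhomogeneous matrix product
`∏_i μ_i^{-|σ_i|} (μ_i)_{|σ_i|} / ((q)_{σ_{i,1}} (q)_{σ_{i,2}}) ·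
Tr(Z_{σ_1}(μ_1) ⋯ Z_{σ_L}(μ_L))`. -/
def inhomProb {L : ℕ} (q : ℝ) (μ : Fin L → ℝ) (σ : Config L) : ℝ :=
  (∏ i, (μ i)⁻¹ ^ size (σ i) * qPoch q (μ i) (size (σ i)) /
    (qPoch q q (σ i).1 * qPoch q q (σ i).2)) * trace (inhomWord q μ σ)

/-- The operator `∏_i (μ b_+)_∞ / (b_+)_∞ k^{σ_{i,2}} b_-^{σ_{i,1}}`, ordered from left to right
along the sites. -/
def homWord {L : ℕ} (q μ : ℝ) (σ : Config L) : Module.End ℝ Fock :=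
  (List.ofFn fun i => dilog q 1 μ * kOp q ^ (σ i).2 * bMinus q ^ (σ i).1).prod

/-- The homogeneous matrix product
`∏_i (μ)_{|σ_i|} / ((q)_{σ_{i,1}} (q)_{σ_{i,2}}) ·
Tr(∏_i (μ b_+)_∞ / (b_+)_∞ k^{σ_{i,2}} b_-^{σ_{i,1}})`. -/
def homProb {L : ℕ} (q μ : ℝ) (σ : Config L) : ℝ :=
  (∏ i, qPoch q μ (size (σ i)) / (qPoch q q (σ i).1 * qPoch q q (σ i).2)) *
    trace (homWord q μ σ)

end QZRP

end

/-! Stationarity comes from one exchange relation. Put `c = μ / l`, `D = (μ b_+)_∞ / (b_+)_∞`, `G =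
(μ b_+)_∞ / (c b_+)_∞`. The power of `q` in `Φ(γ|β)` is the cost of moving `b_-^{β₁-γ₁}` past
`k^{γ₂}`, so `Φ(γ|β)` times the weighted site operator of `β` splits into an operator for the
staying group `β - γ` followed by one for the hopping group `γ` (`smul_siteOp_eq`). Cyclicity of the
trace hands each right factor to the next site, and `(T ℙ)(α)` becomes the trace of a product of
local sums `exchOp`, one for each `α_i`. By `dilog_mul_exchOp`, `G` intertwines `exchOp` with the
original weighted operator; it is invertible and the same at all sites, so it drops out of the
trace.

The exchange relation is reduced to one variable. Since `b_- k = q k b_-`, the `q`-binomial theorem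
makes `(x b_- + k)^n` a generating function in `x` of all site operators with `n` particles. For
these powers the relation is a finite identity, proved by induction on `n` with a telescoping sum
(`exchange_pow`).

Cyclicity on an infinite-dimensional space needs decay: each `k` contributes a factor `q` per level,
and `m₂ ≥ 1` provides at least one (`IsBanded`, `trace_mul_comm`).

The identity `T(l) ℙ = ℙ` holds for every `l ≠ 0`, beyond the stochastic range, and `ℙ` does not
depend on `l`. Hence it may be differentiated at `l = 1`, where `T` is the identity and its
derivative is `-μ H^{(1)}`, and at `l = μ`, where `T` is a rotation of the ring and its derivative
is a rotated `μ⁻¹ H^{(2)}`.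

Uniqueness is a minimum principle for `v / ℙ` with irreducibility (`eq_mul_of_stationary`). The
inhomogeneous formula is reached by conjugating with the diagonal operator `|n⟩ ↦ μ^n |n⟩`, which
leaves diagonal entries unchanged. -/

noncomputable section

namespace QZRP

/-! ## Multiplication operators on the Fock space -/

/-- The operator `φ(b_+)` for a formal power series `φ`, where the Fock space is identified with
the space of formal power series. -/
def mulOp : PowerSeries ℝ →ₐ[ℝ] Module.End ℝ Fock :=
  AlgHom.ofLinearMap
    { toFun := fun φ =>
        { toFun := fun v n => PowerSeries.coeff n (φ * PowerSeries.mk v)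
          map_add' := fun u v => by
            have h : PowerSeries.mk (u + v) = PowerSeries.mk u + PowerSeries.mk v := by
              ext n; simp
            funext n
            simp [h, mul_add]
          map_smul' := fun c v => by
            have h : PowerSeries.mk (c • v) = c • PowerSeries.mk v := by
              ext n; simp
            funext n
            simp [h] }
      map_add' := fun φ ψ => by
        refine LinearMap.ext fun v => ?_
        funext n
        simp [add_mul]
      map_smul' := fun c φ => by
        refine LinearMap.ext fun v => ?_
        funext n
        simp }
    (by
      refine LinearMap.ext fun v => ?_
      funext n
      simp)
    (fun φ ψ => by
      refine LinearMap.ext fun v => ?_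
      have h : PowerSeries.mk (fun n => PowerSeries.coeff n (ψ * PowerSeries.mk v)) =
          ψ * PowerSeries.mk v := by
        ext n; simp
      funext n
      simp only [LinearMap.coe_mk, AddHom.coe_mk, Module.End.mul_apply]
      rw [h, mul_assoc])

theorem mulOp_apply (φ : PowerSeries ℝ) (v : Fock) (n : ℕ) :
    mulOp φ v n = PowerSeries.coeff n (φ * PowerSeries.mk v) := rfl

theorem mulOp_apply_eq_sum (φ : PowerSeries ℝ) (v : Fock) (n : ℕ) :
    mulOp φ v n = ∑ k ∈ Finset.range (n + 1), PowerSeries.coeff (n - k) φ * v k := by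
  rw [mulOp_apply, mul_comm, PowerSeries.coeff_mul,
    Finset.Nat.sum_antidiagonal_eq_sum_range_succ_mk]
  simp [mul_comm]

theorem bPlus_eq_mulOp : bPlus = mulOp PowerSeries.X := by
  refine LinearMap.ext fun v => ?_
  funext n
  rw [mulOp_apply, mul_comm]
  cases n with
  | zero => simp [bPlus]
  | succ n => simp [bPlus, PowerSeries.coeff_succ_mul_X]

/-- The power series of the operator `(z w b_+)_∞ / (z b_+)_∞`. -/
def dilogSeries (q z w : ℝ) : PowerSeries ℝ :=
  PowerSeries.mk fun j => qPoch q w j / qPoch q q j * z ^ j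

theorem dilog_eq_mulOp (q z w : ℝ) : dilog q z w = mulOp (dilogSeries q z w) := by
  refine LinearMap.ext fun v => ?_
  funext n
  rw [mulOp_apply, PowerSeries.coeff_mul, Finset.Nat.sum_antidiagonal_eq_sum_range_succ_mk]
  simp only [dilog, LinearMap.coe_mk, AddHom.coe_mk, dilogSeries, PowerSeries.coeff_mk]
  refine Finset.sum_congr rfl fun j hj => ?_
  have hj' : j ≤ n := Nat.lt_succ_iff.1 (Finset.mem_range.1 hj)
  rw [bPlus_eq_mulOp, ← map_pow, mulOp_apply]
  obtain ⟨k, rfl⟩ := Nat.exists_eq_add_of_le hj'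
  rw [add_comm j k, PowerSeries.coeff_X_pow_mul]
  simp

/-! ## `q`-shifted factorials -/

theorem qPoch_zero (q z : ℝ) : qPoch q z 0 = 1 := by simp [qPoch]

theorem qPoch_succ (q z : ℝ) (n : ℕ) : qPoch q z (n + 1) = qPoch q z n * (1 - z * q ^ n) := by
  simp [qPoch, Finset.prod_range_succ]

theorem qPoch_add (q z : ℝ) (n k : ℕ) :
    qPoch q z (n + k) = qPoch q z n * qPoch q (z * q ^ n) k := by
  simp [qPoch, Finset.prod_range_add, pow_add, mul_assoc]

theorem qPoch_pos {q z : ℝ} (hq0 : 0 < q) (hq1 : q < 1) (hz : z < 1) (n : ℕ) :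
    0 < qPoch q z n := by
  refine Finset.prod_pos fun j _ => ?_
  have h1 : q ^ j ≤ 1 := pow_le_one₀ hq0.le hq1.le
  have h2 : 0 < q ^ j := pow_pos hq0 j
  nlinarith

theorem qPoch_self_succ (q : ℝ) (n : ℕ) :
    qPoch q q (n + 1) = qPoch q q n * (1 - q ^ (n + 1)) := by
  rw [qPoch_succ, pow_succ']

theorem one_sub_pow_pos {q : ℝ} (hq0 : 0 < q) (hq1 : q < 1) (n : ℕ) : 0 < 1 - q ^ (n + 1) :=
  sub_pos.2 (pow_lt_one₀ hq0.le hq1 (Nat.succ_ne_zero n))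

/-! ## Commutation relations of the `q`-boson operators -/

/-- On power series `k` is the dilation `f(X) ↦ f(qX)`, a ring homomorphism. -/
theorem kOp_mul_mulOp (q : ℝ) (φ : PowerSeries ℝ) :
    kOp q * mulOp φ = mulOp (PowerSeries.rescale q φ) * kOp q := by
  refine LinearMap.ext fun v => ?_
  have h : PowerSeries.mk (kOp q v) = PowerSeries.rescale q (PowerSeries.mk v) := by
    ext n; simp [kOp]
  funext n
  rw [Module.End.mul_apply, Module.End.mul_apply, mulOp_apply, h, ← map_mul,
    PowerSeries.coeff_rescale]
  rfl

/-- On power series `b_-` is the `q`-difference `f ↦ (f(X) - f(qX)) / X`; this is its twisted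
Leibniz rule, with `ψ` the `q`-difference of `φ`. -/
theorem bMinus_mul_mulOp (q : ℝ) {φ ψ : PowerSeries ℝ}
    (h : φ - PowerSeries.rescale q φ = PowerSeries.X * ψ) :
    bMinus q * mulOp φ = mulOp (PowerSeries.rescale q φ) * bMinus q + mulOp ψ := by
  refine LinearMap.ext fun v => ?_
  have h' : PowerSeries.X * PowerSeries.mk (bMinus q v) =
      PowerSeries.mk v - PowerSeries.rescale q (PowerSeries.mk v) := by
    ext n
    cases n with
    | zero => rw [map_sub, PowerSeries.coeff_rescale]; simp
    | succ n => simp [bMinus, PowerSeries.coeff_succ_X_mul, sub_mul]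
  funext n
  rw [Module.End.mul_apply, LinearMap.add_apply, Module.End.mul_apply, Pi.add_apply, mulOp_apply,
    mulOp_apply, ← map_add, ← PowerSeries.coeff_succ_X_mul]
  have h2 : PowerSeries.X * (PowerSeries.rescale q φ * PowerSeries.mk (bMinus q v) +
      ψ * PowerSeries.mk v) =
      φ * PowerSeries.mk v - PowerSeries.rescale q (φ * PowerSeries.mk v) := by
    rw [map_mul]
    linear_combination PowerSeries.rescale q φ * h' - PowerSeries.mk v * h
  rw [h2, map_sub, PowerSeries.coeff_rescale]
  simp only [bMinus, LinearMap.coe_mk, AddHom.coe_mk, mulOp_apply]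
  ring

theorem rescale_C (q a : ℝ) : PowerSeries.rescale q (PowerSeries.C a) = PowerSeries.C a := by
  ext n
  rw [PowerSeries.coeff_rescale, PowerSeries.coeff_C]
  split_ifs with h <;> simp [h]

/-- The functional equation of the infinite product: `X ↦ qX` removes the first factor of numerator
and denominator. -/
theorem rescale_dilogSeries {q : ℝ} (hq0 : 0 < q) (hq1 : q < 1) (z w : ℝ) :
    PowerSeries.rescale q (dilogSeries q z w) *
        (1 - PowerSeries.C (z * w) * PowerSeries.X) =
      dilogSeries q z w * (1 - PowerSeries.C z * PowerSeries.X) := by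
  ext n
  rw [mul_sub, mul_sub, mul_one, mul_one, ← mul_assoc, ← mul_assoc, map_sub, map_sub]
  cases n with
  | zero => simp
  | succ n =>
    rw [PowerSeries.coeff_succ_mul_X, PowerSeries.coeff_succ_mul_X, PowerSeries.coeff_mul_C,
      PowerSeries.coeff_mul_C, PowerSeries.coeff_rescale, PowerSeries.coeff_rescale]
    simp only [dilogSeries, PowerSeries.coeff_mk]
    rw [qPoch_succ, qPoch_self_succ]
    have h1 := (one_sub_pow_pos hq0 hq1 n).ne'
    have h2 := (qPoch_pos hq0 hq1 hq1 n).ne'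
    field_simp
    ring

/-- The combination `x b_- + k` of the annihilation operators. -/
def annih (q x : ℝ) : Module.End ℝ Fock := x • bMinus q + kOp q

theorem annih_mul_bPlus (q x : ℝ) :
    annih q x * bPlus = q • (bPlus * annih q x) + ((1 - q) * x) • 1 := by
  have h1 : PowerSeries.rescale q (PowerSeries.X : PowerSeries ℝ) =
      PowerSeries.C q * PowerSeries.X := by
    simp
  have hk := kOp_mul_mulOp q PowerSeries.X
  have hb := bMinus_mul_mulOp q (φ := PowerSeries.X) (ψ := PowerSeries.C (1 - q)) (by
    rw [h1, map_sub, map_one]; ring)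
  rw [h1] at hk hb
  have h2 : mulOp (PowerSeries.C q * PowerSeries.X) = q • bPlus := by
    rw [bPlus_eq_mulOp, ← map_smul, PowerSeries.smul_eq_C_mul]
  have h3 : mulOp (PowerSeries.C (1 - q)) = (1 - q) • 1 := by
    rw [← map_one mulOp, ← map_smul, PowerSeries.smul_eq_C_mul, mul_one]
  rw [h2, ← bPlus_eq_mulOp] at hk hb
  rw [h3] at hb
  rw [annih, add_mul, smul_mul_assoc, hk, hb, mul_add, mul_smul_comm]
  simp only [smul_mul_assoc]
  module

theorem annih_mul_dilog {q : ℝ} (hq0 : 0 < q) (hq1 : q < 1) (x z w : ℝ) :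
    annih q x * dilog q z w * (q • 1 - (z * w) • bPlus) =
      q • (dilog q z w * (1 - z • bPlus) * annih q x) + (x * (z * q - z * w)) • dilog q z w := by
  set F := dilogSeries q z w with hF
  have hR := rescale_dilogSeries hq0 hq1 z w
  rw [← hF] at hR
  -- The extra factor clears the denominator `1 - zwX` that dilation by `q` would create; the
  -- dilation of `φ` is then `q F (1 - zX)`, and its `q`-difference is a scalar multiple of `F`.
  set φ := F * (PowerSeries.C q - PowerSeries.C (z * w) * PowerSeries.X) with hφ
  have h1 : PowerSeries.rescale q φ =
      PowerSeries.C q * (F * (1 - PowerSeries.C z * PowerSeries.X)) := by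
    rw [hφ, map_mul, map_sub, map_mul, rescale_C, rescale_C, PowerSeries.rescale_X]
    linear_combination PowerSeries.C q * hR
  have h2 : φ - PowerSeries.rescale q φ =
      PowerSeries.X * (PowerSeries.C (z * q - z * w) * F) := by
    rw [h1, hφ, map_sub, map_mul, map_mul]
    ring
  have hk := kOp_mul_mulOp q φ
  have hb := bMinus_mul_mulOp q h2
  have e1 : mulOp φ = dilog q z w * (q • 1 - (z * w) • bPlus) := by
    rw [dilog_eq_mulOp, bPlus_eq_mulOp, hφ, map_mul, ← map_one mulOp, ← map_smul, ← map_smul,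
      ← map_sub]
    simp only [PowerSeries.smul_eq_C_mul, mul_one]
    rfl
  have e2 : mulOp (PowerSeries.rescale q φ) = q • (dilog q z w * (1 - z • bPlus)) := by
    rw [h1, dilog_eq_mulOp, bPlus_eq_mulOp, ← map_one mulOp, ← map_smul, ← map_sub, ← map_mul,
      ← map_smul]
    simp only [PowerSeries.smul_eq_C_mul]
    rfl
  have e3 : mulOp (PowerSeries.C (z * q - z * w) * F) = (z * q - z * w) • dilog q z w := by
    rw [dilog_eq_mulOp, ← map_smul, PowerSeries.smul_eq_C_mul]
  rw [e1, e2] at hk hb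
  rw [e3] at hb
  rw [mul_assoc, annih, add_mul, smul_mul_assoc, hk, hb, mul_add, mul_smul_comm]
  simp only [smul_mul_assoc]
  module

theorem bMinus_mul_kOp (q : ℝ) : bMinus q * kOp q = q • (kOp q * bMinus q) := by
  refine LinearMap.ext fun v => ?_
  funext n
  simp only [Module.End.mul_apply, bMinus, kOp, LinearMap.coe_mk, AddHom.coe_mk,
    LinearMap.smul_apply, Pi.smul_apply, smul_eq_mul]
  ring

theorem bMinus_pow_mul_kOp_pow (q : ℝ) (i j : ℕ) :
    bMinus q ^ i * kOp q ^ j = q ^ (i * j) • (kOp q ^ j * bMinus q ^ i) := by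
  have h1 : ∀ j, bMinus q * kOp q ^ j = q ^ j • (kOp q ^ j * bMinus q) := fun j => by
    induction j with
    | zero => simp
    | succ j ih =>
      rw [pow_succ, ← mul_assoc, ih, smul_mul_assoc, mul_assoc, bMinus_mul_kOp, mul_smul_comm,
        smul_smul, mul_assoc, pow_succ]
  induction i with
  | zero => simp
  | succ i ih =>
    rw [pow_succ, mul_assoc, h1, mul_smul_comm, ← mul_assoc, ih, smul_mul_assoc, smul_smul,
      mul_assoc, ← pow_add]
    congr 2
    ring

/-! ## The exchange relation -/

section Exchange

variable {A : Type*} [Ring A] [Algebra ℝ A] {q x μ c : ℝ} {C B D G : A}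

theorem pow_succ_mul_of_qcomm (hCB : C * B = q • (B * C) + ((1 - q) * x) • 1) (n : ℕ) :
    C ^ (n + 1) * B = q ^ (n + 1) • (B * C ^ (n + 1)) + ((1 - q ^ (n + 1)) * x) • C ^ n := by
  induction n with
  | zero => simpa using hCB
  | succ n ih =>
    rw [pow_succ', mul_assoc, ih, mul_add, mul_smul_comm, mul_smul_comm, ← mul_assoc, hCB,
      add_mul, smul_mul_assoc, smul_mul_assoc, one_mul, mul_assoc, ← pow_succ', ← pow_succ']
    module

/-- The summands of the exchange relation telescope. -/
theorem exchange_telescope (hCB : C * B = q • (B * C) + ((1 - q) * x) • 1)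
    (hCD : C * D * (q • 1 - μ • B) = q • (D * (1 - B) * C) + (x * (q - μ)) • D)
    (hq : ∀ n : ℕ, 1 - q ^ (n + 1) ≠ 0) {p r : ℕ → ℝ}
    (hp : ∀ n, p (n + 1) * (1 - q ^ (n + 1)) = p n * (c - μ * q ^ n))
    (hr : ∀ n, r (n + 1) * (1 - q ^ (n + 1)) = r n * (1 - c * q ^ n)) (a b : ℕ) :
    (p a * r (b + 1)) • (C ^ a * D * C ^ (b + 1) * (q • 1 - μ • B)) -
      ((1 - μ * q ^ (a + b)) / (1 - q ^ (a + b + 1)) * (p a * r b)) •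
        (C ^ a * D * C ^ b * (q • C - c • (C * B) + (x * (c - μ)) • 1)) =
      (p a * (1 - q ^ a) * r (b + 1) * q ^ (b + 1) / (1 - q ^ (a + b + 1))) •
        (C ^ a * D * (q • 1 - μ • B) * C ^ (b + 1)) -
      (p (a + 1) * (1 - q ^ (a + 1)) * r b * q ^ b / (1 - q ^ (a + b + 1))) •
        (C ^ (a + 1) * D * (q • 1 - μ • B) * C ^ b) := by
  have e1 : C ^ a * D * C ^ (b + 1) * (q • 1 - μ • B) =
      q • (C ^ a * D * C ^ (b + 1)) - (μ * q ^ (b + 1)) • (C ^ a * D * B * C ^ (b + 1)) -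
        (μ * ((1 - q ^ (b + 1)) * x)) • (C ^ a * D * C ^ b) := by
    rw [mul_sub, mul_smul_comm, mul_one, mul_smul_comm, mul_assoc _ _ B,
      pow_succ_mul_of_qcomm hCB, mul_add, mul_smul_comm, mul_smul_comm, ← mul_assoc]
    module
  have e2 : C ^ a * D * C ^ b * (q • C - c • (C * B) + (x * (c - μ)) • 1) =
      q • (C ^ a * D * C ^ (b + 1)) - (c * q ^ (b + 1)) • (C ^ a * D * B * C ^ (b + 1)) +
        (x * (c - μ) - c * ((1 - q ^ (b + 1)) * x)) • (C ^ a * D * C ^ b) := by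
    rw [mul_add, mul_sub, mul_smul_comm, mul_smul_comm, mul_smul_comm, mul_one,
      mul_assoc _ _ C, ← pow_succ, mul_assoc _ _ (C * B), ← mul_assoc _ C B, ← pow_succ,
      pow_succ_mul_of_qcomm hCB, mul_add, mul_smul_comm, mul_smul_comm, ← mul_assoc]
    module
  have e3 : C ^ a * D * (q • 1 - μ • B) * C ^ (b + 1) =
      q • (C ^ a * D * C ^ (b + 1)) - μ • (C ^ a * D * B * C ^ (b + 1)) := by
    simp only [mul_sub, sub_mul, mul_smul_comm, smul_mul_assoc, mul_one]
  have e4 : C ^ (a + 1) * D * (q • 1 - μ • B) * C ^ b =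
      q • (C ^ a * D * C ^ (b + 1)) - q • (C ^ a * D * B * C ^ (b + 1)) +
        (x * (q - μ)) • (C ^ a * D * C ^ b) := by
    rw [pow_succ, mul_assoc (C ^ a), mul_assoc (C ^ a), hCD, mul_add, add_mul, mul_smul_comm,
      mul_smul_comm, smul_mul_assoc, smul_mul_assoc]
    simp only [mul_sub, sub_mul, mul_one, smul_sub, pow_succ', mul_assoc]
  have h1 := hq b
  have hrb := hr b
  have h2 := inv_mul_cancel₀ (hq (a + b))
  rw [pow_succ] at h1 hrb
  rw [e1, e2, e3, e4, hp a]
  generalize C ^ a * D * C ^ (b + 1) = P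
  generalize C ^ a * D * B * C ^ (b + 1) = Q
  generalize C ^ a * D * C ^ b = R
  -- With `y` as common factor, both `r b` and `r (b + 1)` become polynomial multiples of it, and
  -- the only remaining inverse is that of `1 - q^(a+b+1)`.
  obtain ⟨y, hy⟩ : ∃ y, r b = y * (1 - q ^ b * q) := ⟨_, (div_mul_cancel₀ _ h1).symm⟩
  have hy' : r (b + 1) = y * (1 - c * q ^ b) :=
    mul_right_cancel₀ h1 (by rw [hrb, hy]; ring)
  simp only [div_eq_mul_inv]
  rw [hy, hy']
  generalize (1 - q ^ (a + b + 1))⁻¹ = E at *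
  rw [pow_succ, pow_add] at h2
  simp only [pow_succ q, pow_add q]
  match_scalars
  · linear_combination -(p a * y * (1 - c * q ^ b) * q) * h2
  · linear_combination (p a * y * (1 - c * q ^ b) * μ * q ^ b * q) * h2
  · linear_combination (p a * y * (1 - c * q ^ b) * μ * (1 - q ^ b * q) * x) * h2

/-- Right multiplication by `q - μB` turns the sum for `n + 1` into a scalar times the sum for `n`
followed by `qC - cCB + x(c - μ)`. The same operator arises when `CG` is multiplied by `q - μB`, so
both sides obey one recursion in `n`. -/
theorem exchange_pow (hCB : C * B = q • (B * C) + ((1 - q) * x) • 1)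
    (hCD : C * D * (q • 1 - μ • B) = q • (D * (1 - B) * C) + (x * (q - μ)) • D)
    (hCG : C * G * (q • 1 - μ • B) = q • (G * (1 - c • B) * C) + (x * (c * q - μ)) • G)
    (hGD : G * D = D * G)
    (hcancel : ∀ X Y : A, X * (q • 1 - μ • B) = Y * (q • 1 - μ • B) → X = Y)
    (hq : ∀ n : ℕ, 1 - q ^ (n + 1) ≠ 0) {p r w : ℕ → ℝ}
    (hp0 : p 0 = 1) (hr0 : r 0 = 1) (hw0 : w 0 = 1)
    (hp : ∀ n, p (n + 1) * (1 - q ^ (n + 1)) = p n * (c - μ * q ^ n))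
    (hr : ∀ n, r (n + 1) * (1 - q ^ (n + 1)) = r n * (1 - c * q ^ n))
    (hw : ∀ n, w (n + 1) * (1 - q ^ (n + 1)) = w n * (1 - μ * q ^ n)) (n : ℕ) :
    G * ∑ a ∈ Finset.range (n + 1), (p a * r (n - a)) • (C ^ a * D * C ^ (n - a)) =
      w n • (D * C ^ n * G) := by
  have hCG' : C * G * (q • 1 - μ • B) =
      G * (q • C - c • (C * B) + (x * (c - μ)) • 1) := by
    rw [hCG, hCB]
    simp only [mul_sub, mul_add, sub_mul, mul_smul_comm, smul_mul_assoc, mul_one, mul_assoc]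
    module
  induction n with
  | zero => simp [hp0, hr0, hw0, hGD]
  | succ n ih =>
    have hsum : (∑ a ∈ Finset.range (n + 1 + 1),
          (p a * r (n + 1 - a)) • (C ^ a * D * C ^ (n + 1 - a))) * (q • 1 - μ • B) =
        ((1 - μ * q ^ n) / (1 - q ^ (n + 1))) •
          ((∑ a ∈ Finset.range (n + 1), (p a * r (n - a)) • (C ^ a * D * C ^ (n - a))) *
            (q • C - c • (C * B) + (x * (c - μ)) • 1)) := by
      rw [Finset.sum_range_succ, add_mul, Finset.sum_mul, Finset.sum_mul, Finset.smul_sum,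
        ← sub_eq_zero, add_sub_right_comm, ← Finset.sum_sub_distrib]
      -- Partial sums of the telescoping differences. The boundary term at `N = 0` vanishes through
      -- its factor `1 - q^0`; at `N = n + 1` it cancels the summand split off from the longer sum.
      have key : ∀ N ≤ n + 1, ∑ a ∈ Finset.range N,
          ((p a * r (n + 1 - a)) • (C ^ a * D * C ^ (n + 1 - a)) * (q • 1 - μ • B) -
            ((1 - μ * q ^ n) / (1 - q ^ (n + 1))) •
              ((p a * r (n - a)) • (C ^ a * D * C ^ (n - a)) *
                (q • C - c • (C * B) + (x * (c - μ)) • 1))) =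
          -((p N * (1 - q ^ N) * r (n + 1 - N) * q ^ (n + 1 - N) / (1 - q ^ (n + 1))) •
            (C ^ N * D * (q • 1 - μ • B) * C ^ (n + 1 - N))) := by
        intro N
        induction N with
        | zero => simp
        | succ N ihN =>
          intro hN
          obtain ⟨b, rfl⟩ := Nat.exists_eq_add_of_le (Nat.succ_le_succ_iff.1 hN)
          rw [Finset.sum_range_succ, ihN (by omega)]
          have h := exchange_telescope hCB hCD hq hp hr N b
          have i1 : N + b + 1 - N = b + 1 := by omega
          have i2 : N + b - N = b := by omega
          have i3 : N + b + 1 - (N + 1) = b := by omega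
          rw [i1, i2, i3, smul_mul_assoc, smul_mul_assoc, smul_smul, h]
          abel
      rw [key (n + 1) le_rfl]
      have h1 := hq n
      simp only [Nat.sub_self, pow_zero, mul_one, hr0, smul_mul_assoc]
      rw [mul_div_assoc, div_self h1, mul_one, neg_add_cancel]
    apply hcancel
    rw [mul_assoc, hsum, mul_smul_comm, ← mul_assoc, ih, smul_mul_assoc, smul_mul_assoc, smul_smul,
      pow_succ C]
    rw [mul_assoc, ← hCG', ← mul_assoc, ← mul_assoc, mul_assoc D, mul_assoc]
    have h1 : (1 - μ * q ^ n) / (1 - q ^ (n + 1)) * w n = w (n + 1) := by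
      rw [div_mul_eq_mul_div, mul_comm, ← hw, mul_div_assoc, div_self (hq n), mul_one]
    rw [h1]

end Exchange

/-- The annihilation part `k^{α₂} b_-^{α₁}` of the site operator. -/
def siteOp (q : ℝ) (α : Site) : Module.End ℝ Fock := kOp q ^ α.2 * bMinus q ^ α.1

/-- The weight `(z)_{|α|} / ((q)_{α₁} (q)_{α₂})`. -/
def siteWeight (q z : ℝ) (α : Site) : ℝ :=
  qPoch q z (size α) / (qPoch q q α.1 * qPoch q q α.2)

/-! ### Generating function of the site operators and the local exchange relation -/

theorem annih_mul_siteOp (q x : ℝ) (i j : ℕ) :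
    annih q x * siteOp q (i, j) =
      (x * q ^ j) • siteOp q (i + 1, j) + siteOp q (i, j + 1) := by
  have h := bMinus_pow_mul_kOp_pow q 1 j
  rw [pow_one, one_mul] at h
  simp only [annih, siteOp]
  rw [add_mul, smul_mul_assoc, ← mul_assoc, ← mul_assoc, h, smul_mul_assoc, mul_assoc,
    ← pow_succ', ← pow_succ', smul_smul]

/-- The noncommutative `q`-binomial theorem for the `q`-commuting pair `x b_-`, `k`. -/
theorem annih_pow {q : ℝ} (hq0 : 0 < q) (hq1 : q < 1) (x : ℝ) (n : ℕ) :
    (qPoch q q n)⁻¹ • annih q x ^ n = ∑ α ∈ Finset.HasAntidiagonal.antidiagonal n,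
      (x ^ α.1 * (qPoch q q α.1 * qPoch q q α.2)⁻¹) • siteOp q α := by
  induction n with
  | zero => simp [siteOp, qPoch_zero]
  | succ n ih =>
    have hne : ∀ n, qPoch q q n ≠ 0 := fun n => (qPoch_pos hq0 hq1 hq1 n).ne'
    have h1 := fun n => (one_sub_pow_pos hq0 hq1 n).ne'
    have h : (1 - q ^ (n + 1)) • ((qPoch q q (n + 1))⁻¹ • annih q x ^ (n + 1)) =
        annih q x * ((qPoch q q n)⁻¹ • annih q x ^ n) := by
      rw [mul_smul_comm, ← pow_succ', smul_smul, qPoch_self_succ, mul_inv, mul_left_comm,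
        mul_inv_cancel₀ (h1 n), mul_one]
    apply smul_right_injective _ (h1 n)
    simp only
    rw [h, ih, Finset.smul_sum, Finset.mul_sum]
    -- The splitting `1 - q^(i+j) = q^j (1 - q^i) + (1 - q^j)` is the `q`-Pascal rule: the first
    -- part matches the terms produced by `x b_-`, the second those produced by `k`.
    have split : ∀ α ∈ Finset.HasAntidiagonal.antidiagonal (n + 1),
        (1 - q ^ (n + 1)) • ((x ^ α.1 * (qPoch q q α.1 * qPoch q q α.2)⁻¹) • siteOp q α) =
        (q ^ α.2 * (1 - q ^ α.1) * (x ^ α.1 * (qPoch q q α.1 * qPoch q q α.2)⁻¹)) • siteOp q α +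
        ((1 - q ^ α.2) * (x ^ α.1 * (qPoch q q α.1 * qPoch q q α.2)⁻¹)) • siteOp q α := by
      intro α hα
      rw [← Finset.HasAntidiagonal.mem_antidiagonal.1 hα, smul_smul, ← add_smul, pow_add]
      congr 1
      ring
    rw [Finset.sum_congr rfl split, Finset.sum_add_distrib, Finset.Nat.sum_antidiagonal_succ,
      Finset.Nat.sum_antidiagonal_succ']
    simp only [pow_zero, sub_self, mul_zero, zero_mul, zero_smul, zero_add]
    rw [← Finset.sum_add_distrib]
    refine Finset.sum_congr rfl fun α _ => ?_
    rw [mul_smul_comm, annih_mul_siteOp, smul_add, smul_smul, qPoch_self_succ, qPoch_self_succ]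
    have := hne α.1
    have := hne α.2
    have := h1 α.1
    have := h1 α.2
    congr 2 <;> field_simp
    rw [pow_succ]

/-- The operator replacing a site operator when the transfer matrix is applied. -/
def exchOp (q μ l : ℝ) (α : Site) : Module.End ℝ Fock :=
  ∑ η ∈ Finset.Iic α, ((μ / l) ^ size η * siteWeight q l η * siteWeight q (μ / l) (α - η)) •
    (siteOp q η * (dilog q 1 μ * siteOp q (α - η)))

/-- Both sides run over pairs `(η, δ)` with `|η| + |δ| = n`, grouped by the sum `η + δ` or by the
two sizes. -/
theorem sum_antidiagonal_Iic {M : Type*} [AddCommMonoid M] (F : Site → Site → M) (n : ℕ) :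
    ∑ α ∈ Finset.HasAntidiagonal.antidiagonal n, ∑ η ∈ Finset.Iic α, F η (α - η) =
      ∑ ab ∈ Finset.HasAntidiagonal.antidiagonal n, ∑ η ∈ Finset.HasAntidiagonal.antidiagonal ab.1,
        ∑ δ ∈ Finset.HasAntidiagonal.antidiagonal ab.2, F η δ := by
  simp only [← Finset.sum_product']
  rw [Finset.sum_sigma', Finset.sum_sigma']
  refine Finset.sum_nbij' (fun t => ⟨(size t.2, size (t.1 - t.2)), (t.2, t.1 - t.2)⟩)
    (fun t => ⟨t.2.1 + t.2.2, t.2.1⟩) ?_ ?_ ?_ ?_ ?_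
  · rintro ⟨⟨a, b⟩, ⟨c, d⟩⟩ h
    simp [size] at h ⊢
    omega
  · rintro ⟨⟨a, b⟩, ⟨⟨c, d⟩, ⟨e, f⟩⟩⟩ h
    simp at h ⊢
    omega
  · rintro ⟨⟨a, b⟩, ⟨c, d⟩⟩ h
    simp at h ⊢
    omega
  · rintro ⟨⟨a, b⟩, ⟨⟨c, d⟩, ⟨e, f⟩⟩⟩ h
    simp [size] at h ⊢
    obtain ⟨h1, h2, h3⟩ := h
    simp [h2, h3]
  · rintro ⟨⟨a, b⟩, ⟨c, d⟩⟩ h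
    rfl

/-- Each matrix coefficient is a real polynomial in `x` that vanishes identically, and on an
antidiagonal `α₁` determines `α`, so no two terms share a power of `x`. -/
theorem eq_zero_of_sum_pow_smul_eq_zero {n : ℕ} {Z : Site → Module.End ℝ Fock}
    (h : ∀ x : ℝ, ∑ α ∈ Finset.HasAntidiagonal.antidiagonal n, x ^ α.1 • Z α = 0) :
    ∀ α ∈ Finset.HasAntidiagonal.antidiagonal n, Z α = 0 := by
  intro α hα
  refine LinearMap.ext fun v => ?_
  funext m
  have hp : (∑ β ∈ Finset.HasAntidiagonal.antidiagonal n, Polynomial.monomial β.1 (Z β v m) :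
      Polynomial ℝ) = 0 := by
    refine Polynomial.funext fun x => ?_
    have hx := congrFun (LinearMap.congr_fun (h x) v) m
    simp only [LinearMap.sum_apply, Finset.sum_apply, LinearMap.smul_apply, Pi.smul_apply,
      smul_eq_mul, LinearMap.zero_apply, Pi.zero_apply] at hx
    rw [Polynomial.eval_finsetSum, Polynomial.eval_zero, ← hx]
    exact Finset.sum_congr rfl fun β _ => by rw [Polynomial.eval_monomial, mul_comm]
  have hc := congrArg (fun p => Polynomial.coeff p α.1) hp
  simp only [Polynomial.finsetSum_coeff, Polynomial.coeff_monomial, Polynomial.coeff_zero] at hc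
  rw [Finset.sum_eq_single α] at hc
  · simpa using hc
  · intro β hβ hne
    refine if_neg fun h1 => hne ?_
    rw [Finset.HasAntidiagonal.mem_antidiagonal] at hα hβ
    exact Prod.ext h1 (by omega)
  · exact fun h' => absurd hα h'

theorem mul_sub_bPlus_cancel {q : ℝ} (hq0 : 0 < q) (μ : ℝ) {X Y : Module.End ℝ Fock}
    (h : X * (q • 1 - μ • bPlus) = Y * (q • 1 - μ • bPlus)) : X = Y := by
  set φ : PowerSeries ℝ := PowerSeries.C q - PowerSeries.C μ * PowerSeries.X with hφ
  have hφ0 : PowerSeries.constantCoeff φ ≠ 0 := by simp [hφ, hq0.ne']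
  have e : q • (1 : Module.End ℝ Fock) - μ • bPlus = mulOp φ := by
    rw [bPlus_eq_mulOp, ← map_one mulOp, ← map_smul, ← map_smul, ← map_sub]
    simp only [PowerSeries.smul_eq_C_mul, mul_one, hφ]
  have hi : mulOp φ * mulOp φ⁻¹ = 1 := by
    rw [← map_mul, PowerSeries.mul_inv_cancel _ hφ0, map_one]
  rw [e] at h
  rw [← mul_one X, ← hi, ← mul_assoc, h, mul_assoc, hi, mul_one]

/-- The identity for powers of `x b_- + k` holds for all real `x`; expanding it by `annih_pow` and
comparing powers of `x` isolates the state `α`. -/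
theorem dilog_mul_exchOp {q μ l : ℝ} (hq0 : 0 < q) (hq1 : q < 1) (hl : l ≠ 0) (α : Site) :
    dilog q (μ / l) l * exchOp q μ l α =
      siteWeight q μ α • (dilog q 1 μ * siteOp q α) * dilog q (μ / l) l := by
  have hne : ∀ n, qPoch q q n ≠ 0 := fun n => (qPoch_pos hq0 hq1 hq1 n).ne'
  have h1 := fun n => (one_sub_pow_pos hq0 hq1 n).ne'
  have hμ : μ / l * l = μ := div_mul_cancel₀ μ hl
  set c := μ / l with hc
  set G := dilog q c l with hG
  set D := dilog q 1 μ with hD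
  have key : ∀ x : ℝ, ∑ β ∈ Finset.HasAntidiagonal.antidiagonal (size α), x ^ β.1 •
      (G * exchOp q μ l β - siteWeight q μ β • (D * siteOp q β) * G) = 0 := by
    intro x
    have hCD := annih_mul_dilog hq0 hq1 x 1 μ
    have hCG := annih_mul_dilog hq0 hq1 x c l
    rw [one_mul, one_smul, one_mul] at hCD
    rw [hμ] at hCG
    have hGD : G * D = D * G := by
      rw [hG, hD, dilog_eq_mulOp, dilog_eq_mulOp, ← map_mul, ← map_mul, mul_comm]
    have hpoch : ∀ z n, qPoch q z (n + 1) / qPoch q q (n + 1) * (1 - q ^ (n + 1)) =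
        qPoch q z n / qPoch q q n * (1 - z * q ^ n) := fun z n => by
      rw [qPoch_succ, qPoch_self_succ]
      have := hne n
      have := h1 n
      field_simp
    have h := exchange_pow (annih_mul_bPlus q x) hCD hCG hGD
      (fun X Y => mul_sub_bPlus_cancel hq0 μ) h1
      -- The required recursion for `p` uses `c * l = μ`, that is `c (1 - l q^n) = c - μ q^n`.
      (p := fun a => c ^ a * (qPoch q l a / qPoch q q a))
      (r := fun b => qPoch q c b / qPoch q q b) (w := fun n => qPoch q μ n / qPoch q q n)
      (by simp [qPoch_zero]) (by simp [qPoch_zero]) (by simp [qPoch_zero])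
      (fun n => by
        rw [mul_assoc, hpoch, ← hμ, pow_succ]; ring)
      (fun n => hpoch c n) (fun n => hpoch μ n) (size α)
    have hL : ∑ a ∈ Finset.range (size α + 1),
        (c ^ a * (qPoch q l a / qPoch q q a) * (qPoch q c (size α - a) /
          qPoch q q (size α - a))) • (annih q x ^ a * D * annih q x ^ (size α - a)) =
        ∑ β ∈ Finset.HasAntidiagonal.antidiagonal (size α), x ^ β.1 • exchOp q μ l β := by
      have e1 : ∀ β ∈ Finset.HasAntidiagonal.antidiagonal (size α), x ^ β.1 • exchOp q μ l β =
          ∑ η ∈ Finset.Iic β, (x ^ (η.1 + (β - η).1) * (c ^ size η * siteWeight q l η *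
            siteWeight q c (β - η))) • (siteOp q η * (D * siteOp q (β - η))) := by
        intro β _
        rw [exchOp, Finset.smul_sum]
        refine Finset.sum_congr rfl fun η hη => ?_
        have : η.1 + (β - η).1 = β.1 := Nat.add_sub_of_le (Finset.mem_Iic.1 hη).1
        rw [this, smul_smul]
      rw [Finset.sum_congr rfl e1, sum_antidiagonal_Iic (fun η δ =>
        (x ^ (η.1 + δ.1) * (c ^ size η * siteWeight q l η *
            siteWeight q c δ)) • (siteOp q η * (D * siteOp q δ))),
        Finset.Nat.sum_antidiagonal_eq_sum_range_succ_mk]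
      refine Finset.sum_congr rfl fun a _ => ?_
      have e2 : (c ^ a * (qPoch q l a / qPoch q q a) * (qPoch q c (size α - a) /
          qPoch q q (size α - a))) • (annih q x ^ a * D * annih q x ^ (size α - a)) =
          (c ^ a * qPoch q l a * qPoch q c (size α - a)) •
            (((qPoch q q a)⁻¹ • annih q x ^ a) *
              (D * ((qPoch q q (size α - a))⁻¹ • annih q x ^ (size α - a)))) := by
        simp only [smul_mul_assoc, mul_smul_comm, smul_smul, mul_assoc, div_eq_mul_inv]
        congr 1
        ring
      rw [e2, annih_pow hq0 hq1, annih_pow hq0 hq1, Finset.sum_mul, Finset.smul_sum]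
      refine Finset.sum_congr rfl fun η hη => ?_
      rw [Finset.mul_sum, Finset.mul_sum, Finset.smul_sum]
      refine Finset.sum_congr rfl fun δ hδ => ?_
      rw [Finset.HasAntidiagonal.mem_antidiagonal] at hη hδ
      simp only [siteWeight, size, hη, hδ, smul_mul_assoc, mul_smul_comm, smul_smul]
      congr 1
      ring
    have hR : (qPoch q μ (size α) / qPoch q q (size α)) • (D * annih q x ^ size α * G) =
        ∑ β ∈ Finset.HasAntidiagonal.antidiagonal (size α),
          x ^ β.1 • (siteWeight q μ β • (D * siteOp q β) * G) := by
      have e3 : (qPoch q μ (size α) / qPoch q q (size α)) • (D * annih q x ^ size α * G) =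
          qPoch q μ (size α) • (D * ((qPoch q q (size α))⁻¹ • annih q x ^ size α) * G) := by
        simp only [smul_mul_assoc, mul_smul_comm, smul_smul, div_eq_mul_inv]
      rw [e3, annih_pow hq0 hq1, Finset.mul_sum, Finset.sum_mul, Finset.smul_sum]
      refine Finset.sum_congr rfl fun β hβ => ?_
      rw [Finset.HasAntidiagonal.mem_antidiagonal] at hβ
      simp only [siteWeight, size, hβ, smul_mul_assoc, mul_smul_comm, smul_smul]
      congr 1
      ring
    rw [hL, hR, Finset.mul_sum] at h
    simp only [smul_sub, Finset.sum_sub_distrib]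
    rw [← h, sub_eq_zero]
    exact Finset.sum_congr rfl fun β _ => (mul_smul_comm _ _ _).symm
  exact sub_eq_zero.1 (eq_zero_of_sum_pow_smul_eq_zero key α
    (Finset.HasAntidiagonal.mem_antidiagonal.2 rfl))

/-! ## Banded operators and the trace -/

/-- The coefficient of `|n⟩` in `X |m⟩`. -/
def entry (X : Module.End ℝ Fock) (n m : ℕ) : ℝ := X (Pi.single m 1) n

/-- The operator `X` lowers the level by at most some fixed `d`, so that it is given by its matrix,
and the matrix elements between levels of bounded difference are `O(q^{em})`. -/
def IsBanded (q : ℝ) (e : ℕ) (X : Module.End ℝ Fock) : Prop :=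
  (∃ d, ∀ v n, X v n = ∑ k ∈ Finset.range (n + d + 1), entry X n k * v k) ∧
  ∀ D, ∃ C, 0 ≤ C ∧ ∀ n m, n ≤ m + D → |entry X n m| ≤ C * q ^ (e * m)

theorem entry_eq_zero {X : Module.End ℝ Fock} {d : ℕ}
    (h : ∀ v n, X v n = ∑ k ∈ Finset.range (n + d + 1), entry X n k * v k) {n m : ℕ}
    (hnm : n + d < m) : entry X n m = 0 := by
  rw [entry, h]
  refine Finset.sum_eq_zero fun k hk => ?_
  rw [Pi.single_eq_of_ne, mul_zero]
  have := Finset.mem_range.1 hk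
  omega

theorem entry_mul {X : Module.End ℝ Fock} {d : ℕ}
    (h : ∀ v n, X v n = ∑ k ∈ Finset.range (n + d + 1), entry X n k * v k)
    (Y : Module.End ℝ Fock) (n m : ℕ) :
    entry (X * Y) n m = ∑ k ∈ Finset.range (n + d + 1), entry X n k * entry Y k m :=
  h (Y (Pi.single m 1)) n

/-- In the matrix product only intermediate levels within a bounded distance of `m` survive, so the
number of terms is bounded and the decay exponents add. -/
theorem IsBanded.mul {q : ℝ} (hq0 : 0 < q) (hq1 : q < 1) {e f : ℕ} {X Y : Module.End ℝ Fock}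
    (hX : IsBanded q e X) (hY : IsBanded q f Y) : IsBanded q (e + f) (X * Y) := by
  obtain ⟨⟨d, hd⟩, hXb⟩ := hX
  obtain ⟨⟨d', hd'⟩, hYb⟩ := hY
  refine ⟨⟨d + d', fun v n => ?_⟩, fun D => ?_⟩
  · rw [Module.End.mul_apply, hd]
    simp only [entry_mul hd, Finset.sum_mul]
    rw [Finset.sum_comm]
    refine Finset.sum_congr rfl fun k hk => ?_
    rw [hd' v k, Finset.mul_sum]
    have hk' := Finset.mem_range.1 hk
    rw [← Finset.sum_subset (Finset.range_mono (show k + d' + 1 ≤ n + (d + d') + 1 by omega))]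
    · exact Finset.sum_congr rfl fun j _ => by ring
    · intro j _ hj
      rw [entry_eq_zero hd' (by rw [Finset.mem_range] at hj; omega)]
      ring
  · obtain ⟨C, hC0, hC⟩ := hXb (d' + D)
    obtain ⟨C', hC0', hC'⟩ := hYb (D + d)
    have hqe : 0 < q ^ (e * d') := pow_pos hq0 _
    -- The intermediate level `k` lies between `m - d'` and `m + D + d`, which bounds the number of
    -- terms; replacing `q^(ek)` by `q^(em)` costs `q^(-ed')`.
    refine ⟨(D + d + d' + 1 : ℕ) * (C * (q ^ (e * d'))⁻¹ * C'), by positivity,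
      fun n m hnm => ?_⟩
    rw [entry_mul hd]
    have hsub : ∑ k ∈ Finset.range (n + d + 1), entry X n k * entry Y k m =
        ∑ k ∈ Finset.Ico (m - d') (n + d + 1), entry X n k * entry Y k m := by
      symm
      refine Finset.sum_subset (fun k hk => ?_) fun k _ hk' => ?_
      · exact Finset.mem_range.2 (Finset.mem_Ico.1 hk).2
      · rw [entry_eq_zero hd', mul_zero]
        simp only [Finset.mem_range, Finset.mem_Ico] at *
        omega
    rw [hsub]
    have hterm : ∀ k ∈ Finset.Ico (m - d') (n + d + 1), |entry X n k * entry Y k m| ≤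
        C * (q ^ (e * d'))⁻¹ * C' * q ^ ((e + f) * m) := by
      intro k hk
      rw [Finset.mem_Ico] at hk
      have h1 := hC n k (by omega)
      have h2 := hC' k m (by omega)
      have h3 : q ^ (e * k) ≤ (q ^ (e * d'))⁻¹ * q ^ (e * m) := by
        rw [le_inv_mul_iff₀ hqe, ← pow_add]
        exact pow_le_pow_of_le_one hq0.le hq1.le (by
          rw [← mul_add]
          exact Nat.mul_le_mul_left e (by omega))
      rw [abs_mul]
      calc |entry X n k| * |entry Y k m|
          ≤ (C * q ^ (e * k)) * (C' * q ^ (f * m)) :=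
            mul_le_mul h1 h2 (abs_nonneg _) (by positivity)
        _ ≤ (C * ((q ^ (e * d'))⁻¹ * q ^ (e * m))) * (C' * q ^ (f * m)) := by gcongr
        _ = _ := by rw [add_mul, pow_add]; ring
    calc |∑ k ∈ Finset.Ico (m - d') (n + d + 1), entry X n k * entry Y k m|
        ≤ ∑ k ∈ Finset.Ico (m - d') (n + d + 1), |entry X n k * entry Y k m| :=
          Finset.abs_sum_le_sum_abs _ _
      _ ≤ (Finset.Ico (m - d') (n + d + 1)).card •
            (C * (q ^ (e * d'))⁻¹ * C' * q ^ ((e + f) * m)) :=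
          Finset.sum_le_card_nsmul _ _ _ hterm
      _ ≤ (D + d + d' + 1 : ℕ) * (C * (q ^ (e * d'))⁻¹ * C' * q ^ ((e + f) * m)) := by
          rw [nsmul_eq_mul]
          gcongr
          rw [Nat.card_Ico]
          omega
      _ = _ := by ring

theorem isBanded_one {q : ℝ} : IsBanded q 0 1 := by
  refine ⟨⟨0, fun v n => ?_⟩, fun D => ⟨1, zero_le_one, fun n m _ => ?_⟩⟩
  · rw [Finset.sum_eq_single n]
    · simp [entry]
    · intro k _ hk
      simp [entry, Pi.single_eq_of_ne hk.symm]
    · simp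
  · by_cases h : n = m <;> simp [entry, h]

theorem IsBanded.smul {q : ℝ} {e : ℕ} {X : Module.End ℝ Fock} (hX : IsBanded q e X) (c : ℝ) :
    IsBanded q e (c • X) := by
  obtain ⟨⟨d, hd⟩, hXb⟩ := hX
  refine ⟨⟨d, fun v n => ?_⟩, fun D => ?_⟩
  · rw [LinearMap.smul_apply, Pi.smul_apply, hd, Finset.smul_sum]
    exact Finset.sum_congr rfl fun k _ => by simp [entry, mul_assoc]
  · obtain ⟨C, hC0, hC⟩ := hXb D
    refine ⟨|c| * C, by positivity, fun n m hnm => ?_⟩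
    have : entry (c • X) n m = c * entry X n m := rfl
    rw [this, abs_mul, mul_assoc]
    exact mul_le_mul_of_nonneg_left (hC n m hnm) (abs_nonneg c)

theorem isBanded_mulOp {q : ℝ} (φ : PowerSeries ℝ) : IsBanded q 0 (mulOp φ) := by
  have he : ∀ n m, entry (mulOp φ) n m =
      if m ≤ n then PowerSeries.coeff (n - m) φ else 0 := by
    intro n m
    rw [entry, mulOp_apply_eq_sum]
    simp [Pi.single_apply]
  refine ⟨⟨0, fun v n => ?_⟩, fun D => ?_⟩
  · rw [mulOp_apply_eq_sum]
    refine Finset.sum_congr rfl fun k hk => ?_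
    rw [he, if_pos (Nat.lt_succ_iff.1 (Finset.mem_range.1 hk))]
  · refine ⟨∑ j ∈ Finset.range (D + 1), |PowerSeries.coeff j φ|,
      Finset.sum_nonneg fun _ _ => abs_nonneg _, fun n m hnm => ?_⟩
    rw [he, zero_mul, pow_zero, mul_one]
    split_ifs with h
    · exact Finset.single_le_sum (f := fun j => |PowerSeries.coeff j φ|)
        (fun _ _ => abs_nonneg _) (Finset.mem_range.2 (by omega))
    · rw [abs_zero]
      exact Finset.sum_nonneg fun _ _ => abs_nonneg _

theorem isBanded_dilog (q z w : ℝ) : IsBanded q 0 (dilog q z w) := by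
  rw [dilog_eq_mulOp]
  exact isBanded_mulOp _

theorem entry_kOp (q : ℝ) (n m : ℕ) : entry (kOp q) n m = if n = m then q ^ n else 0 := by
  simp [entry, kOp, Pi.single_apply]

theorem entry_bMinus (q : ℝ) (n m : ℕ) :
    entry (bMinus q) n m = if n + 1 = m then 1 - q ^ (n + 1) else 0 := by
  simp [entry, bMinus, Pi.single_apply]

theorem isBanded_kOp {q : ℝ} (hq0 : 0 < q) : IsBanded q 1 (kOp q) := by
  refine ⟨⟨0, fun v n => ?_⟩, fun D => ⟨1, zero_le_one, fun n m _ => ?_⟩⟩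
  · simp only [entry_kOp]
    simp [kOp]
  · rw [entry_kOp, one_mul, one_mul]
    split_ifs with h
    · rw [h, abs_of_pos (pow_pos hq0 m)]
    · rw [abs_zero]
      positivity

theorem isBanded_bMinus {q : ℝ} (hq0 : 0 < q) (hq1 : q < 1) : IsBanded q 0 (bMinus q) := by
  refine ⟨⟨1, fun v n => ?_⟩, fun D => ⟨1, zero_le_one, fun n m _ => ?_⟩⟩
  · simp only [entry_bMinus]
    simp [bMinus]
  · rw [entry_bMinus, zero_mul, pow_zero, one_mul]
    split_ifs with h
    · have := pow_pos hq0 (n + 1)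
      rw [abs_of_pos (one_sub_pow_pos hq0 hq1 n)]
      linarith
    · simp

theorem IsBanded.pow {q : ℝ} (hq0 : 0 < q) (hq1 : q < 1) {e : ℕ} {X : Module.End ℝ Fock}
    (hX : IsBanded q e X) (n : ℕ) : IsBanded q (n * e) (X ^ n) := by
  induction n with
  | zero => simpa using isBanded_one
  | succ n ih =>
    rw [pow_succ, Nat.succ_mul]
    exact ih.mul hq0 hq1 hX

theorem isBanded_siteOp {q : ℝ} (hq0 : 0 < q) (hq1 : q < 1) (α : Site) :
    IsBanded q α.2 (siteOp q α) := by
  simpa [siteOp] using ((isBanded_kOp hq0).pow hq0 hq1 α.2).mul hq0 hq1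
    ((isBanded_bMinus hq0 hq1).pow hq0 hq1 α.1)

theorem isBanded_ofFn_prod {q : ℝ} (hq0 : 0 < q) (hq1 : q < 1) {n : ℕ} {e : Fin n → ℕ}
    {X : Fin n → Module.End ℝ Fock} (h : ∀ i, IsBanded q (e i) (X i)) :
    IsBanded q (∑ i, e i) (List.ofFn X).prod := by
  induction n with
  | zero => simpa using isBanded_one
  | succ n ih =>
    rw [List.ofFn_succ, List.prod_cons, Fin.sum_univ_succ]
    exact (h 0).mul hq0 hq1 (ih fun i => h i.succ)

/-- The diagonal is dominated by a geometric series; the exponent of the matrix product word is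
`m₂`. -/
theorem IsBanded.traceConverges {q : ℝ} (hq0 : 0 < q) (hq1 : q < 1) {e : ℕ}
    {X : Module.End ℝ Fock} (hX : IsBanded q e X) (he : 1 ≤ e) : TraceConverges X := by
  obtain ⟨C, hC0, hC⟩ := hX.2 0
  refine Summable.of_norm_bounded (g := fun n => C * q ^ n)
    ((summable_geometric_of_lt_one hq0.le hq1).mul_left C) fun n => ?_
  refine (hC n n le_rfl).trans ?_
  gcongr 1
  exact pow_le_pow_of_le_one hq0.le hq1.le (Nat.le_mul_of_pos_left n he)

/-- Fubini for the double series of `X_{nk} Y_{kn}`. Decay in either index suffices, because the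
band conditions keep `n` and `k` at bounded distance. -/
theorem trace_mul_comm {q : ℝ} (hq0 : 0 < q) (hq1 : q < 1) {e f : ℕ} {X Y : Module.End ℝ Fock}
    (hX : IsBanded q e X) (hY : IsBanded q f Y) (hef : 1 ≤ e + f) :
    trace (X * Y) = trace (Y * X) := by
  obtain ⟨⟨d, hd⟩, hXb⟩ := hX
  obtain ⟨⟨d', hd'⟩, hYb⟩ := hY
  obtain ⟨C, hC0, hC⟩ := hXb d'
  obtain ⟨C', hC0', hC'⟩ := hYb d
  have hdiag : ∀ {X : Module.End ℝ Fock} {d : ℕ}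
      (h : ∀ v n, X v n = ∑ k ∈ Finset.range (n + d + 1), entry X n k * v k)
      (Y : Module.End ℝ Fock) (n : ℕ), diagElem (X * Y) n = ∑' k, entry X n k * entry Y k n := by
    intro X d h Y n
    rw [tsum_eq_sum (s := Finset.range (n + d + 1))]
    · exact entry_mul h Y n n
    · intro k hk
      rw [entry_eq_zero h (by rw [Finset.mem_range] at hk; omega), zero_mul]
  -- Passing to `√q` shares the decay equally: `q^k = s^(2k)` is at most a constant times `s^n s^k`
  -- inside the band, and likewise for `q^n`.
  have hs0 : 0 < Real.sqrt q := Real.sqrt_pos.2 hq0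
  have hs1 : Real.sqrt q < 1 := by rw [Real.sqrt_lt' one_pos]; simpa using hq1
  have hss : Real.sqrt q * Real.sqrt q = q := Real.mul_self_sqrt hq0.le
  set s := Real.sqrt q
  have hgeom := summable_geometric_of_lt_one hs0.le hs1
  have hsum : Summable (Function.uncurry fun n k => entry X n k * entry Y k n) := by
    refine Summable.of_norm_bounded
      (g := fun p : ℕ × ℕ => C * C' * (s ^ (d + d'))⁻¹ * (s ^ p.1 * s ^ p.2))
      ((hgeom.mul_of_nonneg hgeom (fun n => (pow_pos hs0 n).le)
        (fun n => (pow_pos hs0 n).le)).mul_left _) ?_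
    rintro ⟨n, k⟩
    simp only [Function.uncurry_apply_pair, Real.norm_eq_abs, abs_mul]
    by_cases h1 : n + d < k
    · rw [entry_eq_zero hd h1, abs_zero, zero_mul]
      positivity
    by_cases h2 : k + d' < n
    · rw [entry_eq_zero hd' h2, abs_zero, mul_zero]
      positivity
    push Not at h1 h2
    have hq : q ^ (e * k) * q ^ (f * n) ≤ (s ^ (d + d'))⁻¹ * (s ^ n * s ^ k) := by
      rw [le_inv_mul_iff₀ (pow_pos hs0 _), ← hss, ← pow_add, ← pow_two, ← pow_mul, ← pow_add,
        ← pow_add]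
      refine pow_le_pow_of_le_one hs0.le hs1.le ?_
      rcases Nat.eq_zero_or_pos e with rfl | he
      · nlinarith
      · nlinarith [Nat.zero_le (f * n)]
    calc |entry X n k| * |entry Y k n| ≤ (C * q ^ (e * k)) * (C' * q ^ (f * n)) :=
          mul_le_mul (hC n k h2) (hC' k n h1) (abs_nonneg _) (by positivity)
      _ = C * C' * (q ^ (e * k) * q ^ (f * n)) := by ring
      _ ≤ C * C' * ((s ^ (d + d'))⁻¹ * (s ^ n * s ^ k)) := by gcongr
      _ = _ := by ring
  simp only [trace, hdiag hd Y, hdiag hd' X]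
  rw [← Summable.tsum_comm hsum]
  simp only [mul_comm]

theorem trace_smul (c : ℝ) (X : Module.End ℝ Fock) : trace (c • X) = c * trace X :=
  tsum_mul_left

theorem trace_sum {ι : Type*} (s : Finset ι) (X : ι → Module.End ℝ Fock)
    (h : ∀ i ∈ s, TraceConverges (X i)) : trace (∑ i ∈ s, X i) = ∑ i ∈ s, trace (X i) := by
  simp only [trace]
  rw [← Summable.tsum_finsetSum h]
  refine tsum_congr fun n => ?_
  simp [diagElem, LinearMap.sum_apply, Finset.sum_apply]

/-! ## Positivity and convergence of the matrix product -/

theorem mem_sector {L : ℕ} {m : Site} {σ : Config L} : σ ∈ sector L m ↔ ∑ i, σ i = m := by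
  rw [sector, Finset.mem_filter, Fintype.mem_piFinset, and_iff_right_iff_imp]
  rintro rfl i
  exact Finset.mem_Iic.2 (Finset.single_le_sum (fun j _ => zero_le) (Finset.mem_univ i))

theorem homWord_eq {L : ℕ} (q μ : ℝ) (σ : Config L) :
    homWord q μ σ = (List.ofFn fun i => dilog q 1 μ * siteOp q (σ i)).prod := by
  simp only [homWord, siteOp, mul_assoc]

theorem homProb_eq {L : ℕ} (q μ : ℝ) (σ : Config L) :
    homProb q μ σ = (∏ i, siteWeight q μ (σ i)) * trace (homWord q μ σ) := rfl

theorem isBanded_homWord {L : ℕ} {q : ℝ} (hq0 : 0 < q) (hq1 : q < 1) (μ : ℝ) {m : Site}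
    {σ : Config L} (hσ : σ ∈ sector L m) : IsBanded q m.2 (homWord q μ σ) := by
  have h := isBanded_ofFn_prod hq0 hq1 fun i =>
    (isBanded_dilog q 1 μ).mul hq0 hq1 (isBanded_siteOp hq0 hq1 (σ i))
  rw [← mem_sector.1 hσ, Prod.snd_sum, homWord_eq]
  simpa using h

theorem entry_dilog (q z w : ℝ) (n m : ℕ) : entry (dilog q z w) n m =
    if m ≤ n then qPoch q w (n - m) / qPoch q q (n - m) * z ^ (n - m) else 0 := by
  rw [dilog_eq_mulOp, entry, mulOp_apply_eq_sum]
  simp [Pi.single_apply, dilogSeries]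

theorem dilog_apply_eq_sum (q z w : ℝ) (v : Fock) (n : ℕ) : dilog q z w v n =
    ∑ k ∈ Finset.range (n + 0 + 1), entry (dilog q z w) n k * v k := by
  rw [dilog_eq_mulOp, mulOp_apply_eq_sum]
  refine Finset.sum_congr rfl fun k hk => ?_
  rw [← dilog_eq_mulOp, entry_dilog, if_pos (Nat.lt_succ_iff.1 (Finset.mem_range.1 hk))]
  simp [dilogSeries]

theorem entry_siteOp_nonneg {q : ℝ} (hq0 : 0 < q) (hq1 : q < 1) (α : Site) (n m : ℕ) :
    0 ≤ entry (siteOp q α) n m := by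
  obtain ⟨i, j⟩ := α
  simp only [siteOp]
  induction j with
  | zero =>
    rw [pow_zero, one_mul]
    induction i generalizing n with
    | zero => by_cases h : n = m <;> simp [entry, h]
    | succ i ih =>
      rw [pow_succ']
      exact mul_nonneg (one_sub_pow_pos hq0 hq1 n).le (ih _)
  | succ j ih =>
    rw [pow_succ', mul_assoc]
    exact mul_nonneg (pow_pos hq0 n).le ih

theorem entry_siteOp_pos {q : ℝ} (hq0 : 0 < q) (hq1 : q < 1) (α : Site) (n : ℕ) :
    0 < entry (siteOp q α) n (n + α.1) := by
  obtain ⟨i, j⟩ := α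
  simp only [siteOp]
  induction j with
  | zero =>
    rw [pow_zero, one_mul]
    induction i generalizing n with
    | zero => simp [entry]
    | succ i ih =>
      rw [pow_succ', ← add_assoc, add_right_comm]
      exact mul_pos (one_sub_pow_pos hq0 hq1 n) (ih _)
  | succ j ih =>
    rw [pow_succ', mul_assoc]
    exact mul_pos (pow_pos hq0 n) ih

theorem entry_dilog_nonneg {q w : ℝ} (hq0 : 0 < q) (hq1 : q < 1) (hw : w < 1) (n m : ℕ) :
    0 ≤ entry (dilog q 1 w) n m := by
  rw [entry_dilog]
  split_ifs
  · have := qPoch_pos hq0 hq1 hw (n - m)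
    have := qPoch_pos hq0 hq1 hq1 (n - m)
    positivity
  · exact le_rfl

theorem entry_ofFn_prod_pos {q : ℝ} {n : ℕ} {e : Fin n → ℕ}
    {X : Fin n → Module.End ℝ Fock} (hX : ∀ i, IsBanded q (e i) (X i))
    (h0 : ∀ i k l, 0 ≤ entry (X i) k l) {N : ℕ} (hpos : ∀ i, 0 < entry (X i) N N) :
    (∀ k l, 0 ≤ entry (List.ofFn X).prod k l) ∧ 0 < entry (List.ofFn X).prod N N := by
  induction n with
  | zero =>
    refine ⟨fun k l => ?_, by simp [entry]⟩
    by_cases h : k = l <;> simp [entry, h]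
  | succ n ih =>
    obtain ⟨ih1, ih2⟩ := ih (fun i => hX i.succ) (fun i => h0 i.succ) (fun i => hpos i.succ)
    obtain ⟨d, hd⟩ := (hX 0).1
    simp only [List.ofFn_succ, List.prod_cons, entry_mul hd]
    refine ⟨fun k l => Finset.sum_nonneg fun j _ => mul_nonneg (h0 0 _ _) (ih1 _ _), ?_⟩
    exact (mul_pos (hpos 0) ih2).trans_le <|
      Finset.single_le_sum (f := fun k => entry (X 0) N k *
        entry (List.ofFn fun i : Fin n => X i.succ).prod k N)
        (fun j _ => mul_nonneg (h0 0 _ _) (ih1 _ _)) (Finset.mem_range.2 (by omega))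

/-- Starting from level `m₁`, no site can lower below the vacuum since `σ_{i,1} ≤ m₁`, and the
series in `b_+` can restore the lost levels at once. So each factor has a positive diagonal entry
there, and nothing can cancel it. -/
theorem entry_homWord_pos {L : ℕ} {q μ : ℝ} (hq0 : 0 < q) (hq1 : q < 1) (hμ1 : μ < 1)
    {m : Site} {σ : Config L} (hσ : σ ∈ sector L m) :
    (∀ k l, 0 ≤ entry (homWord q μ σ) k l) ∧ 0 < entry (homWord q μ σ) m.1 m.1 := by
  rw [homWord_eq]
  have h0 : ∀ i k l n, 0 ≤ entry (dilog q 1 μ) k n * entry (siteOp q (σ i)) n l :=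
    fun i k l n => mul_nonneg (entry_dilog_nonneg hq0 hq1 hμ1 _ _)
      (entry_siteOp_nonneg hq0 hq1 _ _ _)
  refine entry_ofFn_prod_pos (fun i => (isBanded_dilog q 1 μ).mul hq0 hq1
    (isBanded_siteOp hq0 hq1 (σ i))) (fun i k l => ?_) fun i => ?_
  · rw [entry_mul (d := 0) (dilog_apply_eq_sum q 1 μ)]
    exact Finset.sum_nonneg fun n _ => h0 i k l n
  · have hle : (σ i).1 ≤ m.1 := by
      rw [← mem_sector.1 hσ]
      exact (Finset.single_le_sum (f := σ) (fun j _ => zero_le) (Finset.mem_univ i)).1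
    obtain ⟨k, hk⟩ := Nat.exists_eq_add_of_le' hle
    rw [entry_mul (d := 0) (dilog_apply_eq_sum q 1 μ), hk]
    refine lt_of_lt_of_le ?_ (Finset.single_le_sum
      (f := fun n => entry (dilog q 1 μ) (k + (σ i).1) n *
        entry (siteOp q (σ i)) n (k + (σ i).1)) (fun n _ => h0 i _ _ n)
      (Finset.mem_range.2 (show k < _ by omega)))
    refine mul_pos ?_ (entry_siteOp_pos hq0 hq1 _ _)
    rw [entry_dilog, if_pos (by omega)]
    have := qPoch_pos hq0 hq1 hμ1 (k + (σ i).1 - k)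
    have := qPoch_pos hq0 hq1 hq1 (k + (σ i).1 - k)
    positivity

theorem homProb_pos {L : ℕ} {q μ : ℝ} (hq0 : 0 < q) (hq1 : q < 1) (hμ1 : μ < 1)
    {m : Site} (hm : 1 ≤ m.2) {σ : Config L} (hσ : σ ∈ sector L m) : 0 < homProb q μ σ := by
  obtain ⟨h0, h1⟩ := entry_homWord_pos hq0 hq1 hμ1 hσ
  refine mul_pos (Finset.prod_pos fun i _ => ?_) ?_
  · exact div_pos (qPoch_pos hq0 hq1 hμ1 _)
      (mul_pos (qPoch_pos hq0 hq1 hq1 _) (qPoch_pos hq0 hq1 hq1 _))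
  · exact Summable.tsum_pos ((isBanded_homWord hq0 hq1 μ hσ).traceConverges hq0 hq1 hm)
      (fun n => h0 n n) m.1 h1

/-! ## Comparison with the inhomogeneous formula -/

theorem mul_ofFn_prod_of_intertwine {A : Type*} [Ring A] [Algebra ℝ A] {R : A} {n : ℕ}
    {c : Fin n → ℝ} {X Y : Fin n → A} (h : ∀ i, R * X i = c i • (Y i * R)) :
    R * (List.ofFn X).prod = (∏ i, c i) • ((List.ofFn Y).prod * R) := by
  induction n with
  | zero => simp
  | succ n ih =>
    rw [List.ofFn_succ, List.ofFn_succ, List.prod_cons, List.prod_cons, ← mul_assoc, h 0,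
      smul_mul_assoc, mul_assoc, ih fun i => h i.succ, Fin.prod_univ_succ, mul_smul_comm,
      smul_smul, mul_assoc]

theorem kOp_mul_dilog {μ : ℝ} (hμ : μ ≠ 0) (q : ℝ) :
    kOp μ * dilog q μ⁻¹ μ = dilog q 1 μ * kOp μ := by
  rw [dilog_eq_mulOp, kOp_mul_mulOp, dilog_eq_mulOp]
  congr 2
  ext n
  rw [PowerSeries.coeff_rescale]
  simp only [dilogSeries, PowerSeries.coeff_mk, one_pow, inv_pow]
  field_simp

theorem kOp_mul_siteOp {μ : ℝ} (hμ : μ ≠ 0) (q : ℝ) (α : Site) :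
    kOp μ * siteOp q α = μ⁻¹ ^ α.1 • (siteOp q α * kOp μ) := by
  have h1 : kOp μ * kOp q = kOp q * kOp μ := by
    refine LinearMap.ext fun v => ?_
    funext n
    simp only [Module.End.mul_apply, kOp, LinearMap.coe_mk, AddHom.coe_mk]
    ring
  have h2 : kOp μ * bMinus q = μ⁻¹ • (bMinus q * kOp μ) := by
    refine LinearMap.ext fun v => ?_
    funext n
    simp only [Module.End.mul_apply, kOp, bMinus, LinearMap.coe_mk, AddHom.coe_mk,
      LinearMap.smul_apply, Pi.smul_apply, smul_eq_mul, pow_succ]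
    field_simp
  have h3 : ∀ i, kOp μ * bMinus q ^ i = μ⁻¹ ^ i • (bMinus q ^ i * kOp μ) := fun i => by
    induction i with
    | zero => simp
    | succ i ih =>
      rw [pow_succ, ← mul_assoc, ih, smul_mul_assoc, mul_assoc, h2, mul_smul_comm, smul_smul,
        mul_assoc, pow_succ]
  have h4 : Commute (kOp μ) (kOp q ^ α.2) := Commute.pow_right h1 _
  rw [siteOp, ← mul_assoc, h4.eq, mul_assoc, h3, mul_smul_comm, mul_assoc]

theorem diagElem_inhomWord {L : ℕ} {μ : ℝ} (hμ : μ ≠ 0) (q : ℝ) (σ : Config L) (n : ℕ) :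
    diagElem (inhomWord q (fun _ => μ) σ) n =
      (∏ i, μ⁻¹ ^ (σ i).1) * diagElem (homWord q μ σ) n := by
  have h := mul_ofFn_prod_of_intertwine (R := kOp μ) (c := fun i => μ⁻¹ ^ (σ i).1)
    (X := fun i => dilog q μ⁻¹ μ * siteOp q (σ i))
    (Y := fun i => dilog q 1 μ * siteOp q (σ i)) fun i => by
      rw [← mul_assoc, kOp_mul_dilog hμ, mul_assoc, kOp_mul_siteOp hμ, mul_smul_comm, mul_assoc]
  rw [← homWord_eq] at h
  have hw : inhomWord q (fun _ => μ) σ =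
      (List.ofFn fun i => dilog q μ⁻¹ μ * siteOp q (σ i)).prod := by
    simp only [inhomWord, siteOp, mul_assoc]
  rw [← hw] at h
  have he := congrFun (LinearMap.congr_fun h (Pi.single n 1)) n
  -- Basis vectors are eigenvectors of the conjugating operator `kOp μ`, so its eigenvalue `μ^n`
  -- cancels from the diagonal entry.
  have hs : kOp μ (Pi.single n 1) = μ ^ n • (Pi.single n 1 : Fock) := by
    funext k
    by_cases hk : k = n <;> simp [kOp, hk]
  simp only [LinearMap.smul_apply, Pi.smul_apply, Module.End.mul_apply, hs, map_smul,
    smul_eq_mul] at he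
  have he' : μ ^ n * diagElem (inhomWord q (fun _ => μ) σ) n =
      (∏ i, μ⁻¹ ^ (σ i).1) * (μ ^ n * diagElem (homWord q μ σ) n) := he
  rw [mul_left_comm] at he'
  exact mul_left_cancel₀ (pow_ne_zero n hμ) he'

theorem inhomProb_eq {L : ℕ} {μ : ℝ} (hμ : μ ≠ 0) (q : ℝ) {m : Site} {σ : Config L}
    (hσ : σ ∈ sector L m) : inhomProb q (fun _ => μ) σ =
      μ⁻¹ ^ (2 * m.1 + m.2) * homProb q μ σ := by
  have ht : trace (inhomWord q (fun _ => μ) σ) =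
      (∏ i, μ⁻¹ ^ (σ i).1) * trace (homWord q μ σ) := by
    rw [trace, trace, ← tsum_mul_left]
    exact tsum_congr (diagElem_inhomWord hμ q σ)
  have h1 : ∏ i, μ⁻¹ ^ (σ i).1 = μ⁻¹ ^ m.1 := by
    rw [Finset.prod_pow_eq_pow_sum, ← mem_sector.1 hσ, Prod.fst_sum]
  have h2 : ∏ i, μ⁻¹ ^ size (σ i) = μ⁻¹ ^ (m.1 + m.2) := by
    rw [Finset.prod_pow_eq_pow_sum, ← mem_sector.1 hσ, Prod.fst_sum, Prod.snd_sum,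
      ← Finset.sum_add_distrib]
    rfl
  simp only [inhomProb, homProb, mul_div_assoc, Finset.prod_mul_distrib]
  rw [ht, h1, h2, two_mul, add_assoc, pow_add _ m.1]
  ring

/-! ## The discrete time process -/

/-- The `q`-binomials redistribute the denominators of the weight, `(μ)_{|β|}` cancels, and
reordering `b_-` past `k` yields precisely the power of `q` in `Φ`. -/
theorem smul_siteOp_eq {q μ l : ℝ} (hq0 : 0 < q) (hq1 : q < 1) (hμ1 : μ < 1)
    {γ β : Site} (h : γ ≤ β) :
    (Phi q l μ γ β * siteWeight q μ β) • (dilog q 1 μ * siteOp q β) =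
      (siteWeight q (μ / l) (β - γ) • (dilog q 1 μ * siteOp q (β - γ))) *
        (((μ / l) ^ size γ * siteWeight q l γ) • siteOp q γ) := by
  obtain ⟨δ, rfl⟩ := exists_add_of_le h
  obtain ⟨g1, g2⟩ := γ
  obtain ⟨d1, d2⟩ := δ
  have hne : ∀ n, qPoch q q n ≠ 0 := fun n => (qPoch_pos hq0 hq1 hq1 n).ne'
  have hb : ∀ a b, qBinom q (a + b) a = qPoch q q (a + b) / (qPoch q q a * qPoch q q b) :=
    fun a b => by rw [qBinom, if_pos (by omega), Nat.add_sub_cancel_left]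
  have hop : siteOp q (d1, d2) * siteOp q (g1, g2) =
      q ^ (d1 * g2) • siteOp q (g1 + d1, g2 + d2) := by
    simp only [siteOp]
    rw [mul_assoc, ← mul_assoc (bMinus q ^ d1), bMinus_pow_mul_kOp_pow, smul_mul_assoc,
      mul_smul_comm, mul_assoc, ← pow_add, ← mul_assoc, ← pow_add, add_comm d1, add_comm d2]
  have hsub : (g1, g2) + (d1, d2) - (g1, g2) = ((d1, d2) : Site) := by simp
  rw [hsub, smul_mul_smul_comm, mul_assoc, hop, mul_smul_comm, smul_smul, Phi, if_pos h]
  have hs : size (g1 + d1, g2 + d2) = size (g1, g2) + size (d1, d2) := by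
    simp only [size]; omega
  rw [Prod.mk_add_mk, hs, Nat.add_sub_cancel_left]
  simp only [Nat.add_sub_cancel_left, hb, siteWeight, hs]
  congr 1
  have := hne g1
  have := hne g2
  have := hne d1
  have := hne d2
  have := hne (g1 + d1)
  have := hne (g2 + d2)
  have := (qPoch_pos hq0 hq1 hμ1 (size (g1, g2) + size (d1, d2))).ne'
  field_simp

theorem ofFn_prod_smul {A : Type*} [Ring A] [Algebra ℝ A] {n : ℕ} (c : Fin n → ℝ)
    (X : Fin n → A) :
    (List.ofFn fun i => c i • X i).prod = (∏ i, c i) • (List.ofFn X).prod := by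
  simpa using (MultilinearMap.mkPiAlgebraFin ℝ n A).map_smul_univ c X

theorem ofFn_prod_sum {A : Type*} [Ring A] [Algebra ℝ A] {n : ℕ} {κ : Type*} [DecidableEq κ]
    (s : Fin n → Finset κ) (X : Fin n → κ → A) :
    (List.ofFn fun i => ∑ j ∈ s i, X i j).prod =
      ∑ η ∈ Fintype.piFinset s, (List.ofFn fun i => X i (η i)).prod := by
  simpa using (MultilinearMap.mkPiAlgebraFin ℝ n A).map_sum_finset X s

theorem mul_ofFn_prod_mul {M : Type*} [Monoid M] {n : ℕ} (A B : Fin (n + 1) → M) :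
    B 0 * ((List.ofFn fun i : Fin n => A i.castSucc * B i.succ).prod * A (Fin.last n)) =
      (List.ofFn fun i => B i * A i).prod := by
  induction n with
  | zero => simp
  | succ n ih =>
    have h := ih (fun i => A i.succ) (fun i => B i.succ)
    rw [List.ofFn_succ (f := fun i => B i * A i), List.prod_cons, ← h, List.ofFn_succ,
      List.prod_cons]
    simp only [mul_assoc, Fin.castSucc_zero, Fin.succ_castSucc, Fin.succ_last]

/-- Both words are the same cyclic word, cut open just before or just after `B 0`. -/
theorem trace_ofFn_prod_rotate {q : ℝ} (hq0 : 0 < q) (hq1 : q < 1) {L : ℕ} [NeZero L]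
    {a b : Fin L → ℕ} {A B : Fin L → Module.End ℝ Fock} (hA : ∀ i, IsBanded q (a i) (A i))
    (hB : ∀ i, IsBanded q (b i) (B i)) (hab : 1 ≤ ∑ i, (b i + a i)) :
    trace (List.ofFn fun i => A i * B (i + 1)).prod =
      trace (List.ofFn fun i => B i * A i).prod := by
  obtain ⟨n, rfl⟩ := Nat.exists_eq_succ_of_ne_zero (NeZero.ne L)
  rw [← mul_ofFn_prod_mul A B]
  have hY := (isBanded_ofFn_prod hq0 hq1 fun i : Fin n =>
    (hA i.castSucc).mul hq0 hq1 (hB i.succ)).mul hq0 hq1 (hA (Fin.last n))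
  rw [trace_mul_comm hq0 hq1 (hB 0) hY]
  · congr 1
    rw [List.ofFn_succ', List.prod_concat]
    simp only [Fin.coeSucc_eq_succ, Fin.last_add_one, mul_assoc]
  · rw [Finset.sum_add_distrib, Fin.sum_univ_succ b, Fin.sum_univ_castSucc a] at hab
    rw [Finset.sum_add_distrib]
    omega

theorem transferElem_eq {L : ℕ} [NeZero L] (q l μ : ℝ) (β α : Config L) :
    transferElem q l (fun _ => μ) β α =
      ∑ γ ∈ Fintype.piFinset (fun i => Finset.Iic (β i)),
        if ∀ i, γ i + α i = γ (i - 1) + β i then ∏ i, Phi q l μ (γ i) (β i) else 0 := by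
  simp only [transferElem, stochR, Finset.prod_ite_zero, Finset.mem_univ, true_imp_iff]

/-- Given the final configuration `α`, a transition is determined by the groups `η i = γ (i - 1)`
arriving at each site, and these are constrained only by `η i ≤ α i`. -/
theorem sum_sector_transfer {L : ℕ} [NeZero L] {m : Site} {α : Config L} (hα : α ∈ sector L m)
    {M : Type*} [AddCommMonoid M] (F : Config L → Config L → M) :
    ∑ β ∈ sector L m, ∑ γ ∈ Fintype.piFinset (fun i => Finset.Iic (β i)),
        (if ∀ i, γ i + α i = γ (i - 1) + β i then F β γ else 0) =
      ∑ η ∈ Fintype.piFinset (fun i => Finset.Iic (α i)),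
        F (fun i => (α i - η i) + η (i + 1)) (fun i => η (i + 1)) := by
  rw [Finset.sum_sigma', ← Finset.sum_filter]
  refine Finset.sum_nbij' (fun t i => t.2 (i - 1))
    (fun η => ⟨fun i => (α i - η i) + η (i + 1), fun i => η (i + 1)⟩) ?_ ?_ ?_ ?_ ?_
  · rintro ⟨β, γ⟩ h
    simp only [Finset.mem_filter, Finset.mem_sigma, Fintype.mem_piFinset, Finset.mem_Iic] at h ⊢
    intro i
    have h1 := h.2 i
    have h2 := h.1.2 i
    rw [Prod.le_def] at h2 ⊢
    rw [Prod.ext_iff] at h1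
    simp only [Prod.fst_add, Prod.snd_add] at h1
    omega
  · intro η h
    simp only [Finset.mem_filter, Finset.mem_sigma, Fintype.mem_piFinset, Finset.mem_Iic,
      mem_sector] at h hα ⊢
    refine ⟨⟨?_, fun i => le_add_self⟩, fun i => ?_⟩
    · have h1 : ∑ i, η (i + 1) = ∑ i, η i := Equiv.sum_comp (Equiv.addRight (1 : Fin L)) η
      rw [Finset.sum_add_distrib, h1, ← Finset.sum_add_distrib, ← hα]
      exact Finset.sum_congr rfl fun i _ => tsub_add_cancel_of_le (h i)
    · have h2 : α i - η i + η i = α i := tsub_add_cancel_of_le (h i)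
      rw [sub_add_cancel, ← add_assoc, add_comm (η i), h2, add_comm]
  · rintro ⟨β, γ⟩ h
    simp only [Finset.mem_filter, Finset.mem_sigma, Fintype.mem_piFinset, Finset.mem_Iic] at h ⊢
    have e : (fun i => α i - γ (i - 1) + γ (i + 1 - 1)) = β := by
      funext i
      have h1 := h.2 i
      have h2 := h.1.2 i
      rw [add_sub_cancel_right]
      rw [Prod.le_def] at h2
      rw [Prod.ext_iff] at h1 ⊢
      simp only [Prod.fst_add, Prod.snd_add, Prod.fst_sub, Prod.snd_sub] at h1 ⊢
      omega
    simp only [add_sub_cancel_right] at e ⊢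
    rw [e]
  · intro η _
    simp
  · rintro ⟨β, γ⟩ h
    simp only [Finset.mem_filter, Finset.mem_sigma, Fintype.mem_piFinset, Finset.mem_Iic] at h ⊢
    have e : (fun i => α i - γ (i - 1) + γ i) = β := by
      funext i
      have h1 := h.2 i
      have h2 := h.1.2 i
      rw [Prod.le_def] at h2
      rw [Prod.ext_iff] at h1 ⊢
      simp only [Prod.fst_add, Prod.snd_add, Prod.fst_sub, Prod.snd_sub] at h1 ⊢
      omega
    simp only [add_sub_cancel_right]
    rw [e]

theorem isDiscreteSteady_homProb {L : ℕ} [NeZero L] {q μ l : ℝ} (hq0 : 0 < q) (hq1 : q < 1)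
    (hμ1 : μ < 1) (hl : l ≠ 0) {m : Site} (hm : 1 ≤ m.2) :
    IsDiscreteSteady q l (fun _ : Fin L => μ) m (homProb q μ) := by
  intro α hα
  set A : Fin L → Site → Module.End ℝ Fock := fun i η =>
    siteWeight q (μ / l) (α i - η) • (dilog q 1 μ * siteOp q (α i - η)) with hA
  set B : Site → Module.End ℝ Fock := fun η =>
    ((μ / l) ^ size η * siteWeight q l η) • siteOp q η with hB
  have hAb : ∀ i η, IsBanded q (α i - η).2 (A i η) := fun i η => by
    simpa using ((isBanded_dilog q 1 μ).mul hq0 hq1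
      (isBanded_siteOp hq0 hq1 (α i - η))).smul (siteWeight q (μ / l) (α i - η))
  have hBb : ∀ η : Site, IsBanded q η.2 (B η) := fun η => (isBanded_siteOp hq0 hq1 η).smul _
  have step1 : ∑ β ∈ sector L m, transferElem q l (fun _ => μ) β α * homProb q μ β =
      ∑ β ∈ sector L m, ∑ γ ∈ Fintype.piFinset (fun i => Finset.Iic (β i)),
        if ∀ i, γ i + α i = γ (i - 1) + β i then
          trace (List.ofFn fun i => (siteWeight q (μ / l) (β i - γ i) •
            (dilog q 1 μ * siteOp q (β i - γ i))) * B (γ i)).prod else 0 := by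
    refine Finset.sum_congr rfl fun β _ => ?_
    rw [transferElem_eq, Finset.sum_mul]
    refine Finset.sum_congr rfl fun γ hγ => ?_
    rw [ite_mul, zero_mul]
    congr 1
    have hγ' : ∀ i, γ i ≤ β i := fun i => Finset.mem_Iic.1 (Fintype.mem_piFinset.1 hγ i)
    have : (fun i => (siteWeight q (μ / l) (β i - γ i) •
            (dilog q 1 μ * siteOp q (β i - γ i))) * B (γ i)) =
        fun i => (Phi q l μ (γ i) (β i) * siteWeight q μ (β i)) •
          (dilog q 1 μ * siteOp q (β i)) :=
      funext fun i => (smul_siteOp_eq hq0 hq1 hμ1 (hγ' i)).symm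
    rw [this, ofFn_prod_smul (fun i => Phi q l μ (γ i) (β i) * siteWeight q μ (β i))
      (fun i => dilog q 1 μ * siteOp q (β i)), trace_smul, ← homWord_eq, homProb_eq, Finset.prod_mul_distrib,
      mul_assoc]
  have hη : ∀ η ∈ Fintype.piFinset (fun i => Finset.Iic (α i)),
      ∑ i, ((η i).2 + (α i - η i).2) = m.2 := by
    intro η hη
    rw [← mem_sector.1 hα, Prod.snd_sum]
    refine Finset.sum_congr rfl fun i _ => ?_
    exact Nat.add_sub_of_le (Finset.mem_Iic.1 (Fintype.mem_piFinset.1 hη i)).2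
  have step2 : ∑ β ∈ sector L m, transferElem q l (fun _ => μ) β α * homProb q μ β =
      trace (List.ofFn fun i => exchOp q μ l (α i)).prod := by
    rw [step1, sum_sector_transfer hα (fun β γ =>
      trace (List.ofFn fun i => (siteWeight q (μ / l) (β i - γ i) •
            (dilog q 1 μ * siteOp q (β i - γ i))) * B (γ i)).prod)]
    have hex : ∀ i, exchOp q μ l (α i) = ∑ η ∈ Finset.Iic (α i), B η * A i η := fun i => by
      refine Finset.sum_congr rfl fun η _ => ?_
      rw [hA, hB]
      simp only [smul_mul_smul_comm]
    simp only [hex]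
    rw [ofFn_prod_sum, trace_sum]
    · refine Finset.sum_congr rfl fun η h => ?_
      rw [← trace_ofFn_prod_rotate hq0 hq1 (fun i => hAb i (η i)) (fun i => hBb (η i))]
      · simp only [add_tsub_cancel_right, hA]
      · rw [hη η h]
        exact hm
    · intro η h
      refine (isBanded_ofFn_prod hq0 hq1 fun i =>
        (hBb (η i)).mul hq0 hq1 (hAb i (η i))).traceConverges hq0 hq1 ?_
      rw [hη η h]
      exact hm
  rw [step2]
  set φ := dilogSeries q (μ / l) l with hφ
  have hφ0 : PowerSeries.constantCoeff φ ≠ 0 := by simp [hφ, dilogSeries, qPoch_zero]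
  have hG := mul_ofFn_prod_of_intertwine (R := mulOp φ) (c := fun _ => 1)
    (X := fun i => exchOp q μ l (α i))
    (Y := fun i => siteWeight q μ (α i) • (dilog q 1 μ * siteOp q (α i))) fun i => by
      rw [one_smul, hφ, ← dilog_eq_mulOp]
      exact dilog_mul_exchOp hq0 hq1 hl (α i)
  rw [Finset.prod_const_one, one_smul, ofFn_prod_smul (fun i => siteWeight q μ (α i))
    (fun i => dilog q 1 μ * siteOp q (α i)), ← homWord_eq] at hG
  have hi : mulOp φ⁻¹ * mulOp φ = 1 := by
    rw [← map_mul, PowerSeries.inv_mul_cancel _ hφ0, map_one]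
  have hi' : mulOp φ * mulOp φ⁻¹ = 1 := by
    rw [← map_mul, PowerSeries.mul_inv_cancel _ hφ0, map_one]
  have hW := congrArg (fun X => mulOp φ⁻¹ * X) hG
  simp only [← mul_assoc, hi, one_mul] at hW
  rw [hW, mul_assoc, trace_mul_comm hq0 hq1 (isBanded_mulOp _)
    (((isBanded_homWord hq0 hq1 μ hα).smul _).mul hq0 hq1 (isBanded_mulOp _)) (by omega),
    mul_assoc, hi', mul_one, trace_smul, homProb_eq]

/-! ## Moving particles -/

theorem move_add {L : ℕ} {σ : Config L} {i : Fin L} (j : Fin L) {γ : Site} (h : γ ≤ σ i)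
    (k : Fin L) :
    move σ i j γ k + (if k = i then γ else 0) = σ k + if k = j then γ else 0 := by
  have h' : σ i - γ + γ = σ i := tsub_add_cancel_of_le h
  simp only [move, Function.update_apply]
  by_cases hi : k = i
  · subst hi
    by_cases hj : k = j
    · subst hj
      simp [h']
    · simp [hj, h']
  · by_cases hj : k = j
    · subst hj
      simp [hi]
    · simp [hi, hj]

theorem move_eq_iff {L : ℕ} {σ τ : Config L} {i j : Fin L} {γ : Site} (h : γ ≤ σ i) :
    move σ i j γ = τ ↔
      ∀ k, τ k + (if k = i then γ else 0) = σ k + if k = j then γ else 0 := by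
  refine ⟨?_, fun hτ => ?_⟩
  · rintro rfl
    exact move_add j h
  · funext k
    exact add_right_cancel ((move_add j h k).trans (hτ k).symm)

theorem sum_move {L : ℕ} {σ : Config L} {i : Fin L} (j : Fin L) {γ : Site} (h : γ ≤ σ i) :
    ∑ k, move σ i j γ k = ∑ k, σ k := by
  have h1 := Finset.sum_congr (rfl : (Finset.univ : Finset (Fin L)) = _)
    fun k _ => move_add j h k
  rw [Finset.sum_add_distrib, Finset.sum_add_distrib, Finset.sum_ite_eq', Finset.sum_ite_eq',
    if_pos (Finset.mem_univ _), if_pos (Finset.mem_univ _)] at h1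
  exact add_right_cancel h1

theorem move_mem_sector {L : ℕ} {m : Site} {σ : Config L} (hσ : σ ∈ sector L m) {i : Fin L}
    (j : Fin L) {γ : Site} (h : γ ≤ σ i) : move σ i j γ ∈ sector L m := by
  rw [mem_sector, sum_move j h]
  exact mem_sector.1 hσ

theorem move_self {L : ℕ} {σ : Config L} {i : Fin L} {γ : Site} (h : γ ≤ σ i) :
    move σ i i γ = σ :=
  (move_eq_iff h).2 fun _ => rfl

theorem move_zero {L : ℕ} (σ : Config L) (i j : Fin L) : move σ i j 0 = σ :=
  (move_eq_iff zero_le).2 fun k => by simp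

theorem le_move {L : ℕ} {σ : Config L} {i : Fin L} (j : Fin L) {γ : Site} :
    γ ≤ move σ i j γ j := by
  simp only [move, Function.update_self]
  exact le_add_self

theorem move_move {L : ℕ} {σ : Config L} {i : Fin L} (j k : Fin L) {γ : Site} (h : γ ≤ σ i) :
    move (move σ i j γ) j k γ = move σ i k γ := by
  rw [move_eq_iff (le_move j)]
  intro n
  have h1 := move_add j h n
  have h2 := move_add k h n
  apply add_right_cancel (b := if n = i then γ else 0)
  rw [add_right_comm, h2, add_right_comm, ← h1, add_right_comm]

/-! ## The continuous time process as a derivative of the discrete time process -/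

/-- At a point where the hop is deterministic, the product rule leaves only those `γ` that deviate
from `base` at no more than one site. -/
theorem hasDerivAt_transferElem {L : ℕ} [NeZero L] {q μ l₀ : ℝ} {base : Site → Site}
    {Φ' : Site → Site → ℝ} (hbase : ∀ β, base β ≤ β)
    (hΦ : ∀ γ β, γ ≤ β → HasDerivAt (fun l => Phi q l μ γ β) (Φ' γ β) l₀)
    (hv : ∀ γ β, γ ≤ β → Phi q l₀ μ γ β = if γ = base β then 1 else 0) (β α : Config L) :
    HasDerivAt (fun l => transferElem q l (fun _ => μ) β α)
      (∑ i, ∑ g ∈ Finset.Iic (β i),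
        if ∀ j, Function.update (base ∘ β) i g j + α j =
          Function.update (base ∘ β) i g (j - 1) + β j then Φ' g (β i) else 0) l₀ := by
  classical
  simp only [transferElem_eq]
  have h1 : ∀ γ ∈ Fintype.piFinset (fun i => Finset.Iic (β i)), HasDerivAt
      (fun l => if ∀ i, γ i + α i = γ (i - 1) + β i then ∏ i, Phi q l μ (γ i) (β i) else 0)
      (∑ i, if (∀ i, γ i + α i = γ (i - 1) + β i) ∧ ∀ j ∈ Finset.univ.erase i,
        γ j = base (β j) then Φ' (γ i) (β i) else 0) l₀ := by
    intro γ hγ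
    have hγ' : ∀ i, γ i ≤ β i := fun i => Finset.mem_Iic.1 (Fintype.mem_piFinset.1 hγ i)
    by_cases hc : ∀ i, γ i + α i = γ (i - 1) + β i
    · simp only [if_pos hc]
      refine (HasDerivAt.fun_finsetProd (u := Finset.univ)
        fun i _ => hΦ (γ i) (β i) (hγ' i)).congr_deriv ?_
      refine Finset.sum_congr rfl fun i _ => ?_
      rw [Finset.prod_congr rfl fun j _ => hv (γ j) (β j) (hγ' j), Finset.prod_ite_zero,
        Finset.prod_const_one, smul_eq_mul, ite_mul, one_mul, zero_mul]
      simp only [hc, implies_true, true_and]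
      split_ifs <;> rfl
    · simp only [hc, false_and, if_false, Finset.sum_const_zero]
      exact hasDerivAt_const _ _
  refine (HasDerivAt.fun_sum h1).congr_deriv ?_
  rw [Finset.sum_comm]
  refine Finset.sum_congr rfl fun i _ => ?_
  symm
  refine Finset.sum_of_injOn (fun g => Function.update (base ∘ β) i g) ?_ ?_ ?_ ?_
  · intro g _ g' _ h
    simpa using congrFun h i
  · intro g hg
    simp only [Finset.mem_coe, Fintype.mem_piFinset, Finset.mem_Iic] at hg ⊢
    intro j
    by_cases hj : j = i
    · subst hj
      simpa using hg
    · simpa [hj] using hbase (β j)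
  · intro γ hγ hγ'
    refine if_neg fun h => hγ' ⟨γ i, ?_, ?_⟩
    · exact Fintype.mem_piFinset.1 hγ i
    · funext j
      by_cases hj : j = i
      · subst hj
        simp
      · simp [hj, h.2 j (Finset.mem_erase.2 ⟨hj, Finset.mem_univ j⟩)]
  · intro g _
    have : ∀ j ∈ Finset.univ.erase i, Function.update (base ∘ β) i g j = base (β j) :=
      fun j hj => by simp [Finset.ne_of_mem_erase hj]
    simp only [Function.update_self]
    congr 1
    exact propext ⟨fun h => ⟨h, this⟩, fun h => h.1⟩

/-! ### Derivatives of `Φ` at `l = 1` and `l = μ` -/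

theorem continuous_qPoch (q : ℝ) (n : ℕ) : Continuous fun z => qPoch q z n := by
  unfold qPoch
  fun_prop

theorem hasDerivAt_qPoch {q z : ℝ} {n : ℕ} (h : ∀ i < n, 1 - z * q ^ i ≠ 0) :
    HasDerivAt (fun z => qPoch q z n)
      (-(qPoch q z n * ∑ i ∈ Finset.range n, q ^ i / (1 - z * q ^ i))) z := by
  induction n with
  | zero => simpa [qPoch_zero] using hasDerivAt_const z (1 : ℝ)
  | succ n ih =>
    simp only [qPoch_succ]
    have h1 : HasDerivAt (fun z : ℝ => 1 - z * q ^ n) (-(1 * q ^ n)) z :=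
      ((hasDerivAt_id z).mul_const _).const_sub 1
    refine ((ih fun i hi => h i (by omega)).mul h1).congr_deriv ?_
    have h2 := h n (by omega)
    rw [Finset.sum_range_succ]
    generalize ∑ i ∈ Finset.range n, q ^ i / (1 - z * q ^ i) = S
    field_simp
    ring

theorem hasDerivAt_sub_mul {R : ℝ → ℝ} {x : ℝ} (hR : ContinuousAt R x) :
    HasDerivAt (fun y => (x - y) * R y) (-R x) x := by
  rw [hasDerivAt_iff_tendsto_slope]
  refine ((hR.neg.tendsto).mono_left nhdsWithin_le_nhds).congr' ?_
  filter_upwards [self_mem_nhdsWithin] with y hy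
  have : y - x ≠ 0 := sub_ne_zero.2 hy
  rw [slope_def_field]
  simp only [Pi.neg_apply]
  field_simp
  ring

theorem one_sub_mul_pow_pos {q μ : ℝ} (hq0 : 0 < q) (hq1 : q < 1) (hμ1 : μ < 1) (n : ℕ) :
    0 < 1 - μ * q ^ n := by
  have h1 : q ^ n ≤ 1 := pow_le_one₀ hq0.le hq1.le
  have h2 : 0 < q ^ n := pow_pos hq0 n
  nlinarith

theorem qPoch_one_succ (q : ℝ) (n : ℕ) : qPoch q 1 (n + 1) = 0 := by
  rw [add_comm, qPoch_add, qPoch, Finset.prod_range_one]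
  simp

theorem qPoch_succ' (q z : ℝ) (n : ℕ) :
    qPoch q z (n + 1) = (1 - z) * qPoch q (z * q) n := by
  rw [add_comm, qPoch_add, qPoch, Finset.prod_range_one]
  simp

theorem qBinom_zero {q : ℝ} (hq0 : 0 < q) (hq1 : q < 1) (n : ℕ) : qBinom q n 0 = 1 := by
  rw [qBinom, if_pos (Nat.zero_le n), qPoch_zero, one_mul, Nat.sub_zero,
    div_self (qPoch_pos hq0 hq1 hq1 n).ne']

theorem qBinom_add_comm (q : ℝ) (a b : ℕ) : qBinom q (a + b) a = qBinom q (a + b) b := by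
  rw [qBinom, qBinom, if_pos (by omega), if_pos (by omega), Nat.add_sub_cancel_left,
    Nat.add_sub_cancel, mul_comm]

theorem qBinom_self {q : ℝ} (hq0 : 0 < q) (hq1 : q < 1) (n : ℕ) : qBinom q n n = 1 := by
  simpa using (qBinom_add_comm q n 0).trans (qBinom_zero hq0 hq1 n)

theorem qBinom_pos {q : ℝ} (hq0 : 0 < q) (hq1 : q < 1) {n k : ℕ} (h : k ≤ n) :
    0 < qBinom q n k := by
  rw [qBinom, if_pos h]
  exact div_pos (qPoch_pos hq0 hq1 hq1 _)
    (mul_pos (qPoch_pos hq0 hq1 hq1 _) (qPoch_pos hq0 hq1 hq1 _))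

theorem size_eq_zero {α : Site} : size α = 0 ↔ α = 0 := by
  simp [size, Prod.ext_iff]

theorem size_add (α β : Site) : size (α + β) = size α + size β := by
  simp only [size, Prod.fst_add, Prod.snd_add]
  omega

theorem Phi_add (q l μ : ℝ) (γ δ : Site) : Phi q l μ γ (γ + δ) =
    q ^ (δ.1 * γ.2) * (μ / l) ^ size γ *
      (qPoch q l (size γ) * qPoch q (μ / l) (size δ) / qPoch q μ (size γ + size δ)) *
      (qBinom q (γ.1 + δ.1) γ.1 * qBinom q (γ.2 + δ.2) γ.2) := by
  rw [Phi, if_pos le_self_add, size_add, Nat.add_sub_cancel_left, Prod.fst_add, Prod.snd_add,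
    Nat.add_sub_cancel_left]

theorem Phi_one {q μ : ℝ} (hq0 : 0 < q) (hq1 : q < 1) (hμ1 : μ < 1) {γ β : Site} (h : γ ≤ β) :
    Phi q 1 μ γ β = if γ = 0 then 1 else 0 := by
  obtain ⟨δ, rfl⟩ := exists_add_of_le h
  rw [Phi_add]
  split_ifs with h0
  · subst h0
    simp [size, qPoch_zero, qBinom_zero hq0 hq1, (qPoch_pos hq0 hq1 hμ1 _).ne']
  · obtain ⟨n, hn⟩ := Nat.exists_eq_succ_of_ne_zero (mt size_eq_zero.1 h0)
    rw [hn, Nat.succ_eq_add_one, qPoch_one_succ]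
    simp

theorem Phi_self {q μ : ℝ} (hq0 : 0 < q) (hq1 : q < 1) (hμ0 : 0 < μ) (hμ1 : μ < 1) {γ β : Site}
    (h : γ ≤ β) : Phi q μ μ γ β = if γ = β then 1 else 0 := by
  obtain ⟨δ, rfl⟩ := exists_add_of_le h
  rw [Phi_add, div_self hμ0.ne']
  split_ifs with h0
  · obtain rfl : δ = 0 := left_eq_add.1 h0
    simp [size, qPoch_zero, qBinom_self hq0 hq1, (qPoch_pos hq0 hq1 hμ1 _).ne']
  · obtain ⟨n, hn⟩ := Nat.exists_eq_succ_of_ne_zero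
      (mt size_eq_zero.1 (fun h => h0 (left_eq_add.2 h) : δ ≠ 0))
    rw [hn, Nat.succ_eq_add_one, qPoch_one_succ]
    simp

/-- For `γ ≠ 0` the factor `(l)_{|γ|}` has a simple zero at `l = 1`, and the cofactor is the rate;
for `γ = 0` the logarithmic derivative of `(μ/l)_{|β|}` gives the diagonal sum. -/
theorem hasDerivAt_Phi_one {q μ : ℝ} (hq0 : 0 < q) (hq1 : q < 1) (hμ1 : μ < 1)
    {γ β : Site} (h : γ ≤ β) :
    HasDerivAt (fun l => Phi q l μ γ β) (-μ * rateRight q μ γ β) 1 := by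
  obtain ⟨δ, rfl⟩ := exists_add_of_le h
  simp only [Phi_add]
  by_cases h0 : γ = 0
  · subst h0
    have hd : HasDerivAt (fun l : ℝ => μ / l) (-μ) 1 := by
      simpa [div_eq_mul_inv] using (hasDerivAt_inv (one_ne_zero (α := ℝ))).const_mul μ
    have hp : HasDerivAt (fun z => qPoch q z (size δ)) _ (μ / 1) :=
      hasDerivAt_qPoch fun i _ => by
        rw [div_one]
        exact (one_sub_mul_pow_pos hq0 hq1 hμ1 i).ne'
    have hc := (hp.comp (1 : ℝ) hd).div_const (qPoch q μ (size δ))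
    have hne := (qPoch_pos hq0 hq1 hμ1 (size δ)).ne'
    have hs : size (0 : Site) = 0 := rfl
    simp only [hs, qPoch_zero, pow_zero, Prod.fst_zero, Prod.snd_zero, mul_zero, one_mul,
      zero_add, qBinom_zero hq0 hq1, mul_one, rateRight, if_true]
    refine hc.congr_deriv ?_
    rw [div_one]
    generalize ∑ i ∈ Finset.range (size δ), q ^ i / (1 - μ * q ^ i) = S
    field_simp
  · obtain ⟨n, hn⟩ := Nat.exists_eq_succ_of_ne_zero (mt size_eq_zero.1 h0)
    rw [Nat.succ_eq_add_one] at hn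
    have hR : ContinuousAt (fun l => q ^ (δ.1 * γ.2) * (μ / l) ^ (n + 1) *
      (qPoch q (l * q) n * qPoch q (μ / l) (size δ) / qPoch q μ (n + 1 + size δ)) *
      (qBinom q (γ.1 + δ.1) γ.1 * qBinom q (γ.2 + δ.2) γ.2)) 1 := by
      have hd : ContinuousAt (fun l : ℝ => μ / l) 1 :=
        continuousAt_const.div continuousAt_id one_ne_zero
      have h1 : ContinuousAt (fun l => qPoch q (μ / l) (size δ)) 1 :=
        (continuous_qPoch q (size δ)).continuousAt.comp hd
      have h2 : ContinuousAt (fun l => qPoch q (l * q) n) 1 :=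
        ((continuous_qPoch q n).comp (continuous_mul_const q)).continuousAt
      exact ((continuousAt_const.mul (hd.pow _)).mul ((h2.mul h1).div_const _)).mul
        continuousAt_const
    have hfun : (fun l => q ^ (δ.1 * γ.2) * (μ / l) ^ size γ *
      (qPoch q l (size γ) * qPoch q (μ / l) (size δ) / qPoch q μ (size γ + size δ)) *
      (qBinom q (γ.1 + δ.1) γ.1 * qBinom q (γ.2 + δ.2) γ.2)) =
      fun l => (1 - l) * (q ^ (δ.1 * γ.2) * (μ / l) ^ (n + 1) *
      (qPoch q (l * q) n * qPoch q (μ / l) (size δ) / qPoch q μ (n + 1 + size δ)) *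
      (qBinom q (γ.1 + δ.1) γ.1 * qBinom q (γ.2 + δ.2) γ.2)) := by
      funext l
      rw [hn, qPoch_succ']
      ring
    rw [hfun]
    refine (hasDerivAt_sub_mul hR).congr_deriv ?_
    rw [rateRight, if_neg h0, size_add, Nat.add_sub_cancel_left, Prod.fst_add, Prod.snd_add,
      Nat.add_sub_cancel_left, hn, Nat.add_sub_cancel, add_comm (n + 1), qPoch_add q μ, one_mul,
      div_one]
    have h1 := (qPoch_pos hq0 hq1 hμ1 (size δ)).ne'
    generalize qPoch q (μ * q ^ size δ) (n + 1) = Y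
    field_simp
    ring

theorem hasDerivAt_Phi_self {q μ : ℝ} (hq0 : 0 < q) (hq1 : q < 1) (hμ0 : 0 < μ) (hμ1 : μ < 1)
    {γ β : Site} (h : γ ≤ β) :
    HasDerivAt (fun l => Phi q l μ γ β) (μ⁻¹ * rateLeft q μ (β - γ) β) μ := by
  obtain ⟨δ, rfl⟩ := exists_add_of_le h
  have hd : HasDerivAt (fun l : ℝ => μ / l) (-μ⁻¹) μ := by
    refine (((hasDerivAt_inv hμ0.ne').const_mul μ)).congr_deriv ?_
    field_simp
  simp only [Phi_add, add_tsub_cancel_left]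
  by_cases h0 : δ = 0
  · subst h0
    have hp : HasDerivAt (fun z => qPoch q z (size γ)) _ μ :=
      hasDerivAt_qPoch fun i _ => (one_sub_mul_pow_pos hq0 hq1 hμ1 i).ne'
    have hc := (hd.pow (size γ)).mul (hp.div_const (qPoch q μ (size γ)))
    have hne := (qPoch_pos hq0 hq1 hμ1 (size γ)).ne'
    have hs : size (0 : Site) = 0 := rfl
    simp only [hs, qPoch_zero, pow_zero, Prod.fst_zero, Prod.snd_zero, zero_mul, one_mul,
      add_zero, qBinom_self hq0 hq1, mul_one, rateLeft, if_true]
    refine hc.congr_deriv ?_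
    have hsum : ∑ i ∈ Finset.range (size γ), 1 / (1 - μ * q ^ i) =
        size γ + μ * ∑ i ∈ Finset.range (size γ), q ^ i / (1 - μ * q ^ i) := by
      rw [Finset.mul_sum, ← Finset.card_range (size γ), Finset.cast_card,
        Finset.card_range, ← Finset.sum_add_distrib]
      refine Finset.sum_congr rfl fun i _ => ?_
      have := (one_sub_mul_pow_pos hq0 hq1 hμ1 i).ne'
      field_simp
      ring
    rw [hsum]
    simp only [Pi.pow_apply, div_self hμ0.ne', one_pow]
    field_simp
    ring
  · obtain ⟨n, hn⟩ := Nat.exists_eq_succ_of_ne_zero (mt size_eq_zero.1 h0)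
    rw [Nat.succ_eq_add_one] at hn
    -- The simple zero now comes from `(μ/l)_{|δ|}`, whose first factor is `1 - μ/l = (μ -
    -- l)(-l⁻¹)`.
    have hR : ContinuousAt (fun l => -l⁻¹ * (q ^ (δ.1 * γ.2) * (μ / l) ^ size γ *
      (qPoch q l (size γ) * qPoch q (μ / l * q) n / qPoch q μ (size γ + (n + 1))) *
      (qBinom q (γ.1 + δ.1) γ.1 * qBinom q (γ.2 + δ.2) γ.2))) μ := by
      have h1 : ContinuousAt (fun l => qPoch q (μ / l * q) n) μ :=
        (continuous_qPoch q n).continuousAt.comp (hd.continuousAt.mul continuousAt_const)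
      have h2 : ContinuousAt (fun l => qPoch q l (size γ)) μ :=
        (continuous_qPoch q _).continuousAt
      exact (continuousAt_inv₀ hμ0.ne').neg.mul
        (((continuousAt_const.mul (hd.continuousAt.pow _)).mul ((h2.mul h1).div_const _)).mul
        continuousAt_const)
    refine ((hasDerivAt_sub_mul hR).congr_of_eventuallyEq ?_).congr_deriv ?_
    · filter_upwards [eventually_ne_nhds hμ0.ne'] with l hl
      rw [hn, qPoch_succ']
      field_simp
      ring
    · rw [rateLeft, if_neg h0, size_add, Nat.add_sub_cancel, Prod.fst_add, Prod.snd_add,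
        Nat.add_sub_cancel, hn, Nat.add_sub_cancel, qPoch_add q μ, div_self hμ0.ne', one_mul,
        one_pow, qBinom_add_comm q γ.1, qBinom_add_comm q γ.2]
      have h1 := (qPoch_pos hq0 hq1 hμ1 (size γ)).ne'
      rw [mul_div_mul_left _ _ h1]
      ring

/-! ### Stationarity under `H^{(1)}` and `H^{(2)}` -/

theorem sum_deriv_mul_homProb {L : ℕ} [NeZero L] {q μ l₀ : ℝ} (hq0 : 0 < q) (hq1 : q < 1)
    (hμ1 : μ < 1) (hl : l₀ ≠ 0) {m : Site} (hm : 1 ≤ m.2) {α : Config L} (hα : α ∈ sector L m)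
    {T' : Config L → ℝ}
    (hT : ∀ β, HasDerivAt (fun l => transferElem q l (fun _ => μ) β α) (T' β) l₀) :
    ∑ β ∈ sector L m, T' β * homProb q μ β = 0 := by
  have h1 : HasDerivAt
      (fun l => ∑ β ∈ sector L m, transferElem q l (fun _ => μ) β α * homProb q μ β)
      (∑ β ∈ sector L m, T' β * homProb q μ β) l₀ :=
    HasDerivAt.fun_sum fun β _ => (hT β).mul_const _
  refine h1.unique ((hasDerivAt_const l₀ (homProb q μ α)).congr_of_eventuallyEq ?_)
  filter_upwards [eventually_ne_nhds hl] with l hl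
  exact isDiscreteSteady_homProb hq0 hq1 hμ1 hl hm α hα

theorem sum_H1Elem_mul_homProb {L : ℕ} [NeZero L] {q μ : ℝ} (hq0 : 0 < q) (hq1 : q < 1)
    (hμ0 : 0 < μ) (hμ1 : μ < 1) {m : Site} (hm : 1 ≤ m.2) {α : Config L}
    (hα : α ∈ sector L m) :
    ∑ β ∈ sector L m, H1Elem q μ β α * homProb q μ β = 0 := by
  have hT : ∀ β, HasDerivAt (fun l => transferElem q l (fun _ => μ) β α)
      (-μ * H1Elem q μ β α) 1 := by
    intro β
    refine (hasDerivAt_transferElem (base := fun _ => 0) (fun β => zero_le)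
      (fun γ β h => hasDerivAt_Phi_one hq0 hq1 hμ1 h)
      (fun γ β h => Phi_one hq0 hq1 hμ1 h) β α).congr_deriv ?_
    rw [H1Elem, Finset.mul_sum]
    refine Finset.sum_congr rfl fun i _ => ?_
    rw [Finset.mul_sum]
    refine Finset.sum_congr rfl fun g hg => ?_
    rw [mul_ite, mul_zero]
    congr 1
    rw [move_eq_iff (Finset.mem_Iic.1 hg), eq_iff_iff]
    refine forall_congr' fun k => ?_
    simp only [Function.update_apply, Function.comp_apply, sub_eq_iff_eq_add]
    rw [add_comm, add_comm (β k)]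
  have h := sum_deriv_mul_homProb hq0 hq1 hμ1 one_ne_zero hm hα hT
  simp only [mul_assoc, ← Finset.mul_sum] at h
  exact (mul_eq_zero.1 h).resolve_left (neg_ne_zero.2 hμ0.ne')

theorem sum_H2Elem_mul_homProb {L : ℕ} [NeZero L] {q μ : ℝ} (hq0 : 0 < q) (hq1 : q < 1)
    (hμ0 : 0 < μ) (hμ1 : μ < 1) {m : Site} (hm : 1 ≤ m.2) {α : Config L}
    (hα : α ∈ sector L m) :
    ∑ β ∈ sector L m, H2Elem q μ β α * homProb q μ β = 0 := by
  -- At `l = μ` every site sends its whole content to the right, so the target must be compared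
  -- after a rotation by one site.
  have hα' : (fun j => α (j - 1)) ∈ sector L m := by
    rw [mem_sector, ← mem_sector.1 hα]
    exact Equiv.sum_comp (Equiv.subRight (1 : Fin L)) α
  have hT : ∀ β, HasDerivAt (fun l => transferElem q l (fun _ => μ) β (fun j => α (j - 1)))
      (μ⁻¹ * H2Elem q μ β α) μ := by
    intro β
    refine (hasDerivAt_transferElem (base := id) (fun β => le_rfl)
      (fun γ β h => hasDerivAt_Phi_self hq0 hq1 hμ0 hμ1 h)
      (fun γ β h => Phi_self hq0 hq1 hμ0 hμ1 h) β _).congr_deriv ?_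
    rw [H2Elem, Finset.mul_sum]
    refine Finset.sum_congr rfl fun i _ => ?_
    rw [Finset.mul_sum]
    -- If only `g` travels with the rotation, the group `β i - g` stays behind, which in the rotated
    -- frame is a hop to the left.
    refine Finset.sum_nbij' (fun g => β i - g) (fun g => β i - g)
      (fun g _ => Finset.mem_Iic.2 tsub_le_self) (fun g _ => Finset.mem_Iic.2 tsub_le_self)
      (fun g hg => tsub_tsub_cancel_of_le (Finset.mem_Iic.1 hg))
      (fun g hg => tsub_tsub_cancel_of_le (Finset.mem_Iic.1 hg)) fun g hg => ?_
    rw [mul_ite, mul_zero]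
    congr 1
    rw [move_eq_iff tsub_le_self, eq_iff_iff]
    refine Iff.trans ?_ (Equiv.subRight (1 : Fin L)).forall_congr_right
    have hB : ∀ j, Function.update β i g j + (if j = i then β i - g else 0) = β j := by
      intro j
      by_cases hj : j = i
      · subst hj
        simp [add_tsub_cancel_of_le (Finset.mem_Iic.1 hg)]
      · simp [hj]
    refine forall_congr' fun j => ?_
    simp only [Equiv.subRight_apply, Function.id_comp, sub_left_inj]
    have h1 := hB j
    have h2 := hB (j - 1)
    generalize (if j = i then β i - g else 0) = e at *
    generalize (if j - 1 = i then β i - g else 0) = e' at *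
    rw [← h1, ← h2]
    constructor
    · intro h
      have : α (j - 1) = Function.update β i g (j - 1) + e := by
        apply add_left_cancel (a := Function.update β i g j)
        rw [h, add_left_comm]
      rw [this, add_right_comm]
    · intro h
      have : α (j - 1) = Function.update β i g (j - 1) + e := by
        apply add_right_cancel (b := e')
        rw [h, add_right_comm]
      rw [this, add_left_comm]
  have h := sum_deriv_mul_homProb hq0 hq1 hμ1 hμ0.ne' hm hα' hT
  simp only [mul_assoc, ← Finset.mul_sum] at h
  exact (mul_eq_zero.1 h).resolve_left (inv_ne_zero hμ0.ne')

theorem isContinuousSteady_homProb {L : ℕ} [NeZero L] {q μ : ℝ} (hq0 : 0 < q) (hq1 : q < 1)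
    (hμ0 : 0 < μ) (hμ1 : μ < 1) {m : Site} (hm : 1 ≤ m.2) (a b : ℝ) :
    IsContinuousSteady q μ a b m (homProb (L := L) q μ) := by
  intro α hα
  have h1 := sum_H1Elem_mul_homProb hq0 hq1 hμ0 hμ1 hm hα
  have h2 := sum_H2Elem_mul_homProb hq0 hq1 hμ0 hμ1 hm hα
  simp only [HElem, add_mul, Finset.sum_add_distrib, mul_assoc, ← Finset.mul_sum]
  rw [h1, h2, mul_zero, mul_zero, add_zero]

/-! ## Uniqueness of the steady state -/

theorem exists_nsmul_one_eq {L : ℕ} [NeZero L] (x : Fin L) : ∃ k : ℕ, k • (1 : Fin L) = x := by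
  obtain ⟨n, rfl⟩ := Nat.exists_eq_succ_of_ne_zero (NeZero.ne L)
  refine Fin.induction (motive := fun x => ∃ k : ℕ, k • (1 : Fin (n + 1)) = x)
    ⟨0, zero_nsmul _⟩ (fun i ⟨k, hk⟩ => ⟨k + 1, ?_⟩) x
  rw [succ_nsmul, hk, Fin.coeSucc_eq_succ]

/-- Irreducibility. On a ring, steps in one direction carry a group anywhere, including back to its
origin, so the one-way implication becomes an equivalence; emptying the sites one by one into site
`0` links every configuration to a fixed one. -/
theorem forall_sector_of_move {L : ℕ} [NeZero L] {m : Site} {e : Fin L} (he : e = 1 ∨ e = -1)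
    {Z : Config L → Prop}
    (hZ : ∀ σ ∈ sector L m, ∀ i γ, γ ≤ σ i → Z (move σ i (i + e) γ) → Z σ)
    {σ₀ : Config L} (hσ₀ : σ₀ ∈ sector L m) (h₀ : Z σ₀) : ∀ σ ∈ sector L m, Z σ := by
  have h1 : ∀ k : ℕ, ∀ σ ∈ sector L m, ∀ i γ, γ ≤ σ i → Z (move σ i (i + k • e) γ) → Z σ := by
    intro k
    induction k with
    | zero =>
      intro σ _ i γ hγ h
      rwa [zero_nsmul, add_zero, move_self hγ] at h
    | succ k ih =>
      intro σ hσ i γ hγ h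
      refine ih σ hσ i γ hγ (hZ _ (move_mem_sector hσ _ hγ) (i + k • e) γ (le_move _) ?_)
      rwa [move_move _ _ hγ, add_assoc, ← succ_nsmul]
  have h2 : ∀ σ ∈ sector L m, ∀ i j γ, γ ≤ σ i → Z (move σ i j γ) → Z σ := by
    intro σ hσ i j γ hγ h
    rcases he with rfl | rfl
    · obtain ⟨k, hk⟩ := exists_nsmul_one_eq (j - i)
      exact h1 k σ hσ i γ hγ (by rwa [hk, add_sub_cancel])
    · obtain ⟨k, hk⟩ := exists_nsmul_one_eq (i - j)
      exact h1 k σ hσ i γ hγ (by rwa [smul_neg, hk, neg_sub, add_sub_cancel])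
  have h3 : ∀ σ ∈ sector L m, ∀ i j γ, γ ≤ σ i → (Z (move σ i j γ) ↔ Z σ) := by
    intro σ hσ i j γ hγ
    refine ⟨h2 σ hσ i j γ hγ, fun h => h2 _ (move_mem_sector hσ j hγ) j i γ (le_move j) ?_⟩
    rwa [move_move _ _ hγ, move_self hγ]
  have h4 : ∀ n : ℕ, ∀ σ ∈ sector L m,
      (Finset.univ.filter fun i => i ≠ 0 ∧ σ i ≠ 0).card = n →
      (Z σ ↔ Z (Pi.single 0 m)) := by
    intro n
    induction n with
    | zero =>
      intro σ hσ hn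
      rw [Finset.card_eq_zero, Finset.filter_eq_empty_iff] at hn
      have h0 : ∀ i, i ≠ 0 → σ i = 0 := fun i hi => by
        by_contra h
        exact hn (Finset.mem_univ i) ⟨hi, h⟩
      have : σ = Pi.single 0 m := by
        have hs := mem_sector.1 hσ
        rw [Finset.sum_eq_single 0 (fun i _ hi => h0 i hi) (by simp)] at hs
        funext i
        by_cases hi : i = 0
        · subst hi
          simp [hs]
        · simp [hi, h0 i hi]
      rw [this]
    | succ n ih =>
      intro σ hσ hn
      obtain ⟨i, hi⟩ := Finset.card_pos.1 (hn.symm.subst (motive := (0 < ·)) n.succ_pos)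
      have hi' := (Finset.mem_filter.1 hi).2
      have hmv := fun k => move_add (σ := σ) (i := i) 0 le_rfl k
      rw [← h3 σ hσ i 0 (σ i) le_rfl]
      refine ih _ (move_mem_sector hσ 0 le_rfl) ?_
      have : (Finset.univ.filter fun k => k ≠ 0 ∧ move σ i 0 (σ i) k ≠ 0) =
          (Finset.univ.filter fun k => k ≠ 0 ∧ σ k ≠ 0).erase i := by
        ext k
        simp only [Finset.mem_filter, Finset.mem_univ, true_and, Finset.mem_erase]
        have hk := hmv k
        by_cases hk0 : k = 0
        · simp [hk0]
        · by_cases hki : k = i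
          · subst hki
            simp only [if_pos, hk0, if_false, add_zero] at hk
            simp [add_eq_right.1 hk]
          · simp only [hki, hk0, if_false, add_zero] at hk
            simp [hk, hki]
      rw [this, Finset.card_erase_of_mem hi, hn, Nat.add_sub_cancel]
  exact fun σ hσ => (h4 _ σ hσ rfl).2 ((h4 _ σ₀ hσ₀ rfl).1 h₀)

/-- With `c` the minimum of `v / P`, the stationary vector `v - cP` is nonnegative with a zero. At a
zero, stationarity is a vanishing sum of nonnegative terms, so every state with a positive
transition into it is again a zero. The diagonal term drops out there, so its sign is immaterial: `s
= 1` serves discrete time, `s = 0` continuous time. -/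
theorem eq_mul_of_stationary {L : ℕ} [NeZero L] {m : Site} {M : Config L → Config L → ℝ} {s : ℝ}
    {P v : Config L → ℝ} (hP : ∀ σ ∈ sector L m, 0 < P σ)
    (hPs : ∀ α ∈ sector L m, ∑ β ∈ sector L m, M β α * P β = s * P α)
    (hvs : ∀ α ∈ sector L m, ∑ β ∈ sector L m, M β α * v β = s * v α)
    (hM : ∀ α β, β ≠ α → 0 ≤ M β α) {e : Fin L} (he : e = 1 ∨ e = -1)
    (hpos : ∀ σ i γ, γ ≤ σ i → move σ i (i + e) γ ≠ σ → 0 < M σ (move σ i (i + e) γ)) :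
    ∃ c : ℝ, ∀ σ ∈ sector L m, v σ = c * P σ := by
  have hne : (sector L m).Nonempty :=
    ⟨Pi.single 0 m, mem_sector.2 (Finset.sum_pi_single' 0 m Finset.univ |>.trans (by simp))⟩
  obtain ⟨σ₀, hσ₀, hmin⟩ := Finset.exists_min_image _ (fun σ => v σ / P σ) hne
  refine ⟨v σ₀ / P σ₀, fun σ hσ => ?_⟩
  set c := v σ₀ / P σ₀ with hc
  have hu : ∀ σ ∈ sector L m, 0 ≤ v σ - c * P σ := fun σ hσ =>
    sub_nonneg.2 ((le_div_iff₀ (hP σ hσ)).1 (hmin σ hσ))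
  have hus : ∀ α ∈ sector L m, ∑ β ∈ sector L m, M β α * (v β - c * P β) =
      s * (v α - c * P α) := by
    intro α hα
    simp only [mul_sub, mul_left_comm _ c, Finset.sum_sub_distrib, ← Finset.mul_sum]
    rw [hvs α hα, hPs α hα]
  have hback : ∀ β ∈ sector L m, ∀ α ∈ sector L m, β ≠ α → 0 < M β α →
      v α - c * P α = 0 → v β - c * P β = 0 := by
    intro β hβ α hα hβα hpos hz
    have h := hus α hα
    rw [hz, mul_zero, Finset.sum_eq_zero_iff_of_nonneg] at h
    · exact (mul_eq_zero.1 (h β hβ)).resolve_left hpos.ne'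
    · intro τ hτ
      by_cases hτα : τ = α
      · rw [hτα, hz, mul_zero]
      · exact mul_nonneg (hM α τ hτα) (hu τ hτ)
  refine sub_eq_zero.1 (forall_sector_of_move (Z := fun σ => v σ - c * P σ = 0) he ?_ hσ₀ ?_ σ hσ)
  · intro σ hσ i γ hγ h
    -- Trivial moves occur for `γ = 0`, and for all groups when `L = 1`.
    by_cases hmv : move σ i (i + e) γ = σ
    · rwa [hmv] at h
    · exact hback σ hσ _ (move_mem_sector hσ _ hγ) (Ne.symm hmv) (hpos σ i γ hγ hmv) h
  · rw [hc, div_mul_cancel₀ _ (hP σ₀ hσ₀).ne', sub_self]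

/-! ### Positivity of transition elements and uniqueness for both processes -/

theorem Phi_pos {q l μ : ℝ} (hq0 : 0 < q) (hq1 : q < 1) (hμ0 : 0 < μ) (hμl : μ < l) (hl1 : l < 1)
    {γ β : Site} (h : γ ≤ β) : 0 < Phi q l μ γ β := by
  rw [Phi, if_pos h]
  have hl0 := hμ0.trans hμl
  have h1 : μ / l < 1 := (div_lt_one hl0).2 hμl
  have := qPoch_pos hq0 hq1 hl1 (size γ)
  have := qPoch_pos hq0 hq1 h1 (size β - size γ)
  have := qPoch_pos hq0 hq1 (hμl.trans hl1) (size β)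
  have := qBinom_pos hq0 hq1 h.1
  have := qBinom_pos hq0 hq1 h.2
  positivity

theorem mul_pow_lt_one {q μ : ℝ} (hq0 : 0 < q) (hq1 : q < 1) (hμ1 : μ < 1) (n : ℕ) :
    μ * q ^ n < 1 :=
  sub_pos.1 (one_sub_mul_pow_pos hq0 hq1 hμ1 n)

theorem rateRight_pos {q μ : ℝ} (hq0 : 0 < q) (hq1 : q < 1) (hμ0 : 0 < μ) (hμ1 : μ < 1)
    {γ α : Site} (h : γ ≤ α) (h0 : γ ≠ 0) : 0 < rateRight q μ γ α := by
  rw [rateRight, if_neg h0]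
  have := qPoch_pos hq0 hq1 hq1 (size γ - 1)
  have := qPoch_pos hq0 hq1 (mul_pow_lt_one hq0 hq1 hμ1 (size α - size γ)) (size γ)
  have := qBinom_pos hq0 hq1 h.1
  have := qBinom_pos hq0 hq1 h.2
  positivity

theorem rateLeft_pos {q μ : ℝ} (hq0 : 0 < q) (hq1 : q < 1) (hμ1 : μ < 1)
    {γ α : Site} (h : γ ≤ α) (h0 : γ ≠ 0) : 0 < rateLeft q μ γ α := by
  rw [rateLeft, if_neg h0]
  have := qPoch_pos hq0 hq1 hq1 (size γ - 1)
  have := qPoch_pos hq0 hq1 (mul_pow_lt_one hq0 hq1 hμ1 (size α - size γ)) (size γ)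
  have := qBinom_pos hq0 hq1 h.1
  have := qBinom_pos hq0 hq1 h.2
  positivity

theorem sum_rate_nonneg {L : ℕ} {r : Site → Site → ℝ}
    (hr : ∀ γ α, γ ≤ α → γ ≠ 0 → 0 < r γ α) (t : Fin L → Fin L) {α β : Config L} (h : β ≠ α)
    (i : Fin L) (γ : Site) (hγ : γ ≤ β i) :
    0 ≤ if move β i (t i) γ = α then r γ (β i) else 0 := by
  split_ifs with hmv
  · refine (hr γ (β i) hγ ?_).le
    rintro rfl
    exact h (by rw [← hmv, move_zero])
  · exact le_rfl

theorem sum_rate_pos {L : ℕ} {r : Site → Site → ℝ}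
    (hr : ∀ γ α, γ ≤ α → γ ≠ 0 → 0 < r γ α) (t : Fin L → Fin L) {σ : Config L} {i : Fin L}
    {γ : Site} (hγ : γ ≤ σ i) (h : move σ i (t i) γ ≠ σ) :
    0 < ∑ k, ∑ g ∈ Finset.Iic (σ k),
      if move σ k (t k) g = move σ i (t i) γ then r g (σ k) else 0 := by
  have hnn := sum_rate_nonneg hr t (Ne.symm h)
  refine Finset.sum_pos' (fun k _ => Finset.sum_nonneg fun g hg =>
    hnn k g (Finset.mem_Iic.1 hg)) ⟨i, Finset.mem_univ i, ?_⟩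
  refine Finset.sum_pos' (fun g hg => hnn i g (Finset.mem_Iic.1 hg))
    ⟨γ, Finset.mem_Iic.2 hγ, ?_⟩
  rw [if_pos rfl]
  refine hr γ (σ i) hγ ?_
  rintro rfl
  exact h (move_zero σ i (t i))

theorem transferElem_nonneg {L : ℕ} [NeZero L] {q l μ : ℝ} (hq0 : 0 < q) (hq1 : q < 1)
    (hμ0 : 0 < μ) (hμl : μ < l) (hl1 : l < 1) (β α : Config L) :
    0 ≤ transferElem q l (fun _ => μ) β α := by
  rw [transferElem_eq]
  refine Finset.sum_nonneg fun γ hγ => ?_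
  split_ifs
  · exact Finset.prod_nonneg fun i _ =>
      (Phi_pos hq0 hq1 hμ0 hμl hl1 (Finset.mem_Iic.1 (Fintype.mem_piFinset.1 hγ i))).le
  · exact le_rfl

theorem transferElem_move_pos {L : ℕ} [NeZero L] {q l μ : ℝ} (hq0 : 0 < q) (hq1 : q < 1)
    (hμ0 : 0 < μ) (hμl : μ < l) (hl1 : l < 1) (σ : Config L) {i : Fin L} {g : Site}
    (hg : g ≤ σ i) : 0 < transferElem q l (fun _ => μ) σ (move σ i (i + 1) g) := by
  rw [transferElem_eq]
  have hP : ∀ γ ∈ Fintype.piFinset (fun i => Finset.Iic (σ i)),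
      0 < ∏ i, Phi q l μ (γ i) (σ i) := fun γ hγ => Finset.prod_pos fun i _ =>
    Phi_pos hq0 hq1 hμ0 hμl hl1 (Finset.mem_Iic.1 (Fintype.mem_piFinset.1 hγ i))
  have hmem : Pi.single i g ∈ Fintype.piFinset (fun i => Finset.Iic (σ i)) := by
    rw [Fintype.mem_piFinset]
    intro j
    by_cases hj : j = i
    · subst hj
      simpa using hg
    · simp [hj]
  refine Finset.sum_pos' (fun γ hγ => ?_) ⟨Pi.single i g, hmem, ?_⟩
  · split_ifs
    · exact (hP γ hγ).le
    · exact le_rfl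
  · rw [if_pos]
    · exact hP _ hmem
    · intro j
      have h := move_add (i + 1) hg j
      simp only [Pi.single_apply, sub_eq_iff_eq_add]
      rw [add_comm, h, add_comm]

theorem eq_mul_homProb_of_isDiscreteSteady {L : ℕ} [NeZero L] {q l μ : ℝ} (hq0 : 0 < q)
    (hq1 : q < 1) (hμ0 : 0 < μ) (hμl : μ < l) (hl1 : l < 1) {m : Site} (hm : 1 ≤ m.2)
    {v : Config L → ℝ} (hv : IsDiscreteSteady q l (fun _ : Fin L => μ) m v) :
    ∃ c : ℝ, ∀ σ ∈ sector L m, v σ = c * homProb q μ σ := by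
  have hμ1 := hμl.trans hl1
  refine eq_mul_of_stationary (s := 1) (M := fun β α => transferElem q l (fun _ => μ) β α)
    (fun σ hσ => homProb_pos hq0 hq1 hμ1 hm hσ) (fun α hα => ?_) (fun α hα => ?_)
    (fun α β _ => transferElem_nonneg hq0 hq1 hμ0 hμl hl1 β α) (Or.inl rfl)
    (fun σ i γ hγ _ => transferElem_move_pos hq0 hq1 hμ0 hμl hl1 σ hγ)
  · rw [one_mul]
    exact isDiscreteSteady_homProb hq0 hq1 hμ1 (hμ0.trans hμl).ne' hm α hα
  · rw [one_mul]
    exact hv α hα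

theorem eq_mul_homProb_of_isContinuousSteady {L : ℕ} [NeZero L] {q μ a b : ℝ} (hq0 : 0 < q)
    (hq1 : q < 1) (hμ0 : 0 < μ) (hμ1 : μ < 1) (ha : 0 ≤ a) (hb : 0 ≤ b) (hab : 0 < a + b)
    {m : Site} (hm : 1 ≤ m.2) {v : Config L → ℝ} (hv : IsContinuousSteady q μ a b m v) :
    ∃ c : ℝ, ∀ σ ∈ sector L m, v σ = c * homProb q μ σ := by
  have hr1 : ∀ γ α : Site, γ ≤ α → γ ≠ 0 → 0 < rateRight q μ γ α :=
    fun γ α => rateRight_pos hq0 hq1 hμ0 hμ1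
  have hr2 : ∀ γ α : Site, γ ≤ α → γ ≠ 0 → 0 < rateLeft q μ γ α :=
    fun γ α => rateLeft_pos hq0 hq1 hμ1
  have h1 : ∀ α β : Config L, β ≠ α → 0 ≤ H1Elem q μ β α := fun α β h =>
    Finset.sum_nonneg fun i _ => Finset.sum_nonneg fun γ hγ =>
      sum_rate_nonneg hr1 (fun i => i + 1) h i γ (Finset.mem_Iic.1 hγ)
  have h2 : ∀ α β : Config L, β ≠ α → 0 ≤ H2Elem q μ β α := fun α β h =>
    Finset.sum_nonneg fun i _ => Finset.sum_nonneg fun γ hγ =>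
      sum_rate_nonneg hr2 (fun i => i - 1) h i γ (Finset.mem_Iic.1 hγ)
  have hP : ∀ σ ∈ sector L m, 0 < homProb q μ σ := fun σ hσ => homProb_pos hq0 hq1 hμ1 hm hσ
  have hM : ∀ α β : Config L, β ≠ α → 0 ≤ HElem q μ a b β α := fun α β h =>
    add_nonneg (mul_nonneg ha (h1 α β h)) (mul_nonneg hb (h2 α β h))
  have hPs : ∀ α ∈ sector L m, ∑ β ∈ sector L m, HElem q μ a b β α * homProb q μ β =
      0 * homProb q μ α := fun α hα => by
    rw [zero_mul]
    exact isContinuousSteady_homProb hq0 hq1 hμ0 hμ1 hm a b α hα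
  have hvs : ∀ α ∈ sector L m, ∑ β ∈ sector L m, HElem q μ a b β α * v β = 0 * v α :=
    fun α hα => by
      rw [zero_mul]
      exact hv α hα
  -- One direction of hopping suffices for irreducibility: left moves if `a = 0`, right moves
  -- otherwise.
  rcases ha.eq_or_lt with rfl | ha'
  · have hb' : 0 < b := by simpa using hab
    refine eq_mul_of_stationary hP hPs hvs hM (Or.inr rfl) fun σ i γ hγ h => ?_
    refine add_pos_of_nonneg_of_pos (mul_nonneg ha (h1 _ _ (Ne.symm h))) (mul_pos hb' ?_)
    rw [← sub_eq_add_neg] at h ⊢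
    exact sum_rate_pos hr2 (fun i => i - 1) hγ h
  · refine eq_mul_of_stationary hP hPs hvs hM (Or.inl rfl) fun σ i γ hγ h => ?_
    exact add_pos_of_pos_of_nonneg
      (mul_pos ha' (sum_rate_pos hr1 (fun i => i + 1) hγ h))
      (mul_nonneg hb (h2 _ _ (Ne.symm h)))

end QZRP

end

theorem mainTheorem4 (L : ℕ) [NeZero L] (q μ : ℝ) (hq0 : 0 < q) (hq1 : q < 1)
    (hμ0 : 0 < μ) (hμ1 : μ < 1) (m : QZRP.Site) (hm : 1 ≤ m.2) :
    -- the traces converge, and the weights are positive, hence normalizable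
    (∀ σ ∈ QZRP.sector L m,
      QZRP.TraceConverges (QZRP.homWord q μ σ) ∧ 0 < QZRP.homProb q μ σ) ∧
    -- they give the steady state of the homogeneous discrete time process, unique up to a scalar
    (∀ l : ℝ, μ < l → l < 1 →
      QZRP.IsDiscreteSteady q l (fun _ : Fin L => μ) m (QZRP.homProb q μ) ∧
      ∀ v : QZRP.Config L → ℝ, QZRP.IsDiscreteSteady q l (fun _ : Fin L => μ) m v →
        ∃ c : ℝ, ∀ σ ∈ QZRP.sector L m, v σ = c * QZRP.homProb q μ σ) ∧
    -- and of the continuous time process, where uniqueness needs a nonzero Markov matrix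
    (∀ a b : ℝ, 0 ≤ a → 0 ≤ b →
      QZRP.IsContinuousSteady q μ a b m (QZRP.homProb (L := L) q μ) ∧
      (0 < a + b → ∀ v : QZRP.Config L → ℝ, QZRP.IsContinuousSteady q μ a b m v →
        ∃ c : ℝ, ∀ σ ∈ QZRP.sector L m, v σ = c * QZRP.homProb q μ σ)) ∧
    -- relation to the specialization of the inhomogeneous formula
    (∀ σ ∈ QZRP.sector L m,
      QZRP.TraceConverges (QZRP.inhomWord q (fun _ => μ) σ) ∧
      QZRP.inhomProb q (fun _ => μ) σ =
        μ⁻¹ ^ (2 * m.1 + m.2) * QZRP.homProb q μ σ) := by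
  have hne : μ ≠ 0 := hμ0.ne'
  refine ⟨fun σ hσ => ⟨?_, QZRP.homProb_pos hq0 hq1 hμ1 hm hσ⟩, fun l hl hl1 => ⟨?_, fun v hv => ?_⟩,
    fun a b ha hb => ⟨?_, fun hab v hv => ?_⟩, fun σ hσ => ⟨?_, QZRP.inhomProb_eq hne q hσ⟩⟩
  · exact (QZRP.isBanded_homWord hq0 hq1 μ hσ).traceConverges hq0 hq1 hm
  · exact QZRP.isDiscreteSteady_homProb hq0 hq1 hμ1 (hμ0.trans hl).ne' hm
  · exact QZRP.eq_mul_homProb_of_isDiscreteSteady hq0 hq1 hμ0 hl hl1 hm hv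
  · exact QZRP.isContinuousSteady_homProb hq0 hq1 hμ0 hμ1 hm a b
  · exact QZRP.eq_mul_homProb_of_isContinuousSteady hq0 hq1 hμ0 hμ1 ha hb hab hm hv
  · have h := (QZRP.isBanded_homWord hq0 hq1 μ hσ).traceConverges hq0 hq1 hm
    exact (h.mul_left _).congr fun n => (QZRP.diagElem_inhomWord hne q σ n).symm
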